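/- All sites are small; sheaves and presheaves are set-valued. A distributor $H : \mathcal{C} \looparrowright \mathcal{D}$ is a functor $\mathcal{D}^{\mathrm{op}} \times \mathcal{C} \to \mathbf{Set}$; distributors compose by $(G \otimes H)(d,b) = \int^{c} H(c,b) \times G(d,c)$. Let $\mathrm{lext}_H : \widehat{\mathcal{C}} \to \widehat{\mathcal{D}}$, $\mathrm{lext}_H(X)(d) = \int^{c} H(d,c)\times X(c)$, and let $\mathrm{rest}_H(Y)(c) = \mathrm{Hom}(H(-,c),Y)$ be its right adjoint. For topologies $J$ on $\mathcal{C}$ and $K$ on $\mathcal{D}$, $H$ is a *distributor of sites* $(\mathcal{C},J) \looparrowright (\mathcal{D},K)$ if * (cover-distributing) for every $x \in H(d,c)$ and every $J$-covering sieve $S$ on $c$, the sieve of all $v : d' \to d$ such that $H(v,c)(x) = H(d',f)(x')$ for some $f : c' \to c$ in $S$ and some $x' \in H(d',c')$ is $K$-covering; * ($K$-flat) (i) for every $d$, the $v : d' \to d$ such that some $H(d',c)$ is inhabited form a $K$-covering sieve; (ii) for $x \in H(d,c)$, $x' \in H(d,c')$, the $v : d'\to d$ such that $H(v,c)(x)$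 and $H(v,c')(x')$ are the images of one $x'' \in H(d',c'')$ along some span $c \leftarrow c'' \to c'$ form a $K$-covering sieve; (iii) for $f,f' : c' \rightrightarrows c$ and $x \in H(d,c')$ with $H(d,f)(x) = H(d,f')(x)$, the $v : d' \to d$ such that $H(v,c')(x) = H(d',g)(x')$ for some $g : c''\to c'$ with $fg=f'g$ and some $x'\in H(d',c'')$ form a $K$-covering sieve. Small sites, distributors of sites (composed by $\otimes$, with units the hom-distributors) and natural transformations form a bicategory $\mathbf{Site}^{\looparrowright}$. Let $\mathbf{Site}^{\flat}$ (resp. $\mathbf{Site}^{\sharp}$) be the 2-category of small sites, morphisms of sites, i.e. cover-preserving and covering-flat functors (resp. comorphisms of sites, i.e. cover-lifting functors), and natural transformations. Here $f : \mathcal{C}\to(\mathcal{D},K)$ is covering-flat if, for every finite diagram $A$ in $\mathcal{C}$ and every cone over $fA$ with vertex $d$, the arrows $v : d' \to d$ along which the cone factors through the $f$-image of a cone over $A$ form a $K$-covering sieve. Let $\mathbf{Top}$ be the bicategory of Grothendieck toposes, geometric morphisms, and natural transformations between inverse images. Write $a$ for sheafification and $i$ for the inclusion of sheaves in presheaves.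 One has the pseudofunctors * $\mathrm{Sh} : (\mathbf{Site}^{\looparrowright})^{\mathrm{op}} \to \mathbf{Top}$, sending $(\mathcal C,J)$ to $\mathrm{Sh}(\mathcal C,J)$ and $H : (\mathcal{C},J)\looparrowright(\mathcal{D},K)$ to the geometric morphism $\mathrm{Sh}(\mathcal{D},K) \to \mathrm{Sh}(\mathcal{C},J)$ with inverse image $a_K\, \mathrm{lext}_H\, i_J$ and direct image the restriction of $\mathrm{rest}_H$; * $\mathrm{Sh}^{\flat} : (\mathbf{Site}^{\flat})^{\mathrm{op}} \to \mathbf{Top}$, sending a morphism of sites $f : (\mathcal{C},J)\to(\mathcal{D},K)$ to the geometric morphism $\mathrm{Sh}(\mathcal{D},K) \to \mathrm{Sh}(\mathcal{C},J)$ with inverse image $a_K\, \mathrm{lan}_{f^{\mathrm{op}}}\, i_J$ and direct image precomposition with $f^{\mathrm{op}}$; * $C : (\mathbf{Site}^{\sharp})^{\mathrm{co}} \to \mathbf{Top}$, sending a comorphism of sites $f : (\mathcal{D},K)\to(\mathcal{C},J)$ to the geometric morphism $\mathrm{Sh}(\mathcal{D},K) \to \mathrm{Sh}(\mathcal{C},J)$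 with inverse image $a_K\,(-\circ f^{\mathrm{op}})\, i_J$ and direct image $\mathrm{ran}_{f^{\mathrm{op}}}$. **Theorem.** (1) For every morphism of sites $f : (\mathcal{C},J) \to (\mathcal{D},K)$, the representable $\mathcal{D}(1,f) : (d,c) \mapsto \mathcal{D}(d,f c)$ is a distributor of sites $(\mathcal{C},J) \looparrowright (\mathcal{D},K)$. (2) For every comorphism of sites $f : (\mathcal{D},K) \to (\mathcal{C},J)$, the corepresentable $\mathcal{C}(f,1) : (d,c) \mapsto \mathcal{C}(f d,c)$ is a distributor of sites $(\mathcal{C},J) \looparrowright (\mathcal{D},K)$. (3) The assignments $f \mapsto \mathcal{D}(1,f)$, $(\phi : f \Rightarrow g) \mapsto (\mathcal{D}(1,\phi) : \mathcal{D}(1,f) \Rightarrow \mathcal{D}(1,g))$, with the canonical isomorphisms $\mathcal{C}(1,1)\cong \hom_{\mathcal C}$ and $\mathcal{E}(1,gf) \cong \mathcal{E}(1,g)\otimes\mathcal{D}(1,f)$, form a pseudofunctor $R : (\mathbf{Site}^{\flat})^{\mathrm{op}} \to (\mathbf{Site}^{\looparrowright})^{\mathrm{op}}$ which is the identity on objects.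 The assignments $f \mapsto \mathcal{C}(f,1)$, $(\phi : f \Rightarrow g) \mapsto (\mathcal{C}(\phi,1) : \mathcal{C}(g,1) \Rightarrow \mathcal{C}(f,1))$, with the canonical isomorphisms $\mathcal{C}(1,1)\cong\hom_{\mathcal C}$ and $\mathcal{E}(gf,1)\cong \mathcal{D}(f,1)\otimes\mathcal{E}(g,1)$ (for $f$ into $\mathcal D$ and $g : \mathcal D \to \mathcal E$), form a pseudofunctor $L : (\mathbf{Site}^{\sharp})^{\mathrm{co}} \to (\mathbf{Site}^{\looparrowright})^{\mathrm{op}}$ which is the identity on objects. (4) There are invertible pseudonatural transformations $\mathrm{Sh}\circ R \cong \mathrm{Sh}^{\flat}$ and $\mathrm{Sh}\circ L \cong C$ whose components at all sites are identity geometric morphisms. -/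

import Mathlib

open CategoryTheory Opposite Bicategory

universe u

namespace SiteDistributors

noncomputable section

set_option linter.unusedSimpArgs false

section Distributors

variable {B C D E : Type u} [SmallCategory B] [SmallCategory C] [SmallCategory D] [SmallCategory E]

/-- The set `H(d, c)` of heteromorphisms from `d` to `c` of a distributor `H : C ⇸ D`. A distributor
`H : C ⇸ D`, i.e. a functor `Dᵒᵖ × C ⥤ Type u`, is taken in its curried form `C ⥤ Dᵒᵖ ⥤ Type u`. -/
abbrev Het (H : Profunctor.{u} C D) (d : D) (c : C) : Type u := (H.obj c).obj (op d)

/-- The covariant action `H(d, u) : H(d, c) → H(d, c')` of `u : c ⟶ c'`. -/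
abbrev Het.push {H : Profunctor.{u} C D} {d : D} {c c' : C} (x : Het H d c) (f : c ⟶ c') :
    Het H d c' := (H.map f).app (op d) x

/-- The contravariant action `H(v, c) : H(d, c) → H(d', c)` of `v : d' ⟶ d`. -/
abbrev Het.pull {H : Profunctor.{u} C D} {d d' : D} {c : C} (x : Het H d c) (v : d' ⟶ d) :
    Het H d' c := (H.obj c).map v.op x

/-- Triples `(c, x, s)` with `x ∈ H(d, c)` and `s ∈ X(c)`. -/
structure LextPre (H : Profunctor.{u} C D) (X : Cᵒᵖ ⥤ Type u) (d : D) : Type u where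
  c : C
  x : Het H d c
  s : X.obj (op c)

/-- The relation `(c, x, X(f) s) ∼ (c', H(d, f) x, s)` for `f : c ⟶ c'`. -/
inductive LextRel (H : Profunctor.{u} C D) (X : Cᵒᵖ ⥤ Type u) (d : D) :
    LextPre H X d → LextPre H X d → Prop
  | mk {c c' : C} (f : c ⟶ c') (x : Het H d c) (s : X.obj (op c')) :
      LextRel H X d ⟨c, x, X.map f.op s⟩ ⟨c', x.push f, s⟩

/-- The coend `∫^c H(d, c) × X(c)`. -/
def LextObj (H : Profunctor.{u} C D) (X : Cᵒᵖ ⥤ Type u) (d : D) : Type u := Quot (LextRel H X d)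

/-- The class of `(c, x, s)` in the coend `∫^c H(d, c) × X(c)`. -/
def LextObj.mk {H : Profunctor.{u} C D} {X : Cᵒᵖ ⥤ Type u} {d : D} {c : C} (x : Het H d c)
    (s : X.obj (op c)) : LextObj H X d := Quot.mk _ ⟨c, x, s⟩

lemma LextObj.sound {H : Profunctor.{u} C D} {X : Cᵒᵖ ⥤ Type u} {d : D} {c c' : C} (f : c ⟶ c')
    (x : Het H d c) (s : X.obj (op c')) :
    LextObj.mk x (X.map f.op s) = LextObj.mk (X := X) (x.push f) s :=
  Quot.sound (.mk f x s)

lemma LextObj.ind {H : Profunctor.{u} C D} {X : Cᵒᵖ ⥤ Type u} {d : D} {P : LextObj H X d → Prop}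
    (h : ∀ (c : C) (x : Het H d c) (s : X.obj (op c)), P (LextObj.mk x s)) (z : LextObj H X d) :
    P z := Quot.ind (fun ⟨c, x, s⟩ => h c x s) z

/-- Functions out of the coend. -/
def LextObj.lift {H : Profunctor.{u} C D} {X : Cᵒᵖ ⥤ Type u} {d : D} {T : Type u}
    (φ : ∀ (c : C), Het H d c → X.obj (op c) → T)
    (h : ∀ {c c' : C} (f : c ⟶ c') (x : Het H d c) (s : X.obj (op c')),
      φ c x (X.map f.op s) = φ c' (x.push f) s) (z : LextObj H X d) : T :=
  Quot.lift (fun p => φ p.c p.x p.s) (by rintro _ _ ⟨f, x, s⟩; exact h f x s) z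

lemma Het.push_pull {H : Profunctor.{u} C D} {d d' : D} {c c' : C} (x : Het H d c) (f : c ⟶ c')
    (v : d' ⟶ d) : (x.push f).pull v = (x.pull v).push f :=
  (NatTrans.naturality_apply (H.map f) v.op x).symm

lemma Het.push_id {H : Profunctor.{u} C D} {d : D} {c : C} (x : Het H d c) : x.push (𝟙 c) = x := by
  simp [Het.push]

lemma Het.push_comp {H : Profunctor.{u} C D} {d : D} {c c' c'' : C} (x : Het H d c) (f : c ⟶ c')
    (g : c' ⟶ c'') : x.push (f ≫ g) = (x.push f).push g := by
  simp [Het.push]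

lemma Het.pull_id {H : Profunctor.{u} C D} {d : D} {c : C} (x : Het H d c) : x.pull (𝟙 d) = x := by
  simp [Het.pull]

lemma Het.pull_comp {H : Profunctor.{u} C D} {d d' d'' : D} {c : C} (x : Het H d c) (v : d' ⟶ d)
    (w : d'' ⟶ d') : x.pull (w ≫ v) = (x.pull v).pull w := by
  simp [Het.pull]

/-- The left extension `lext_H : PSh(C) ⥤ PSh(D)` along a distributor `H : C ⇸ D`, given by the
coends `lext_H(X)(d) = ∫^c H(d, c) × X(c)`. -/
def lext (H : Profunctor.{u} C D) : (Cᵒᵖ ⥤ Type u) ⥤ (Dᵒᵖ ⥤ Type u) where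
  obj X :=
    { obj := fun d => LextObj H X d.unop
      map := fun v => ↾(LextObj.lift (fun _ x s => LextObj.mk (Het.pull x v.unop) s)
        (fun f x s => (LextObj.sound f (Het.pull x v.unop) s).trans (by rw [Het.push_pull])))
      map_id := fun d => by
        ext z; induction z using LextObj.ind with
        | h c x s => exact congrArg (LextObj.mk · s) (Het.pull_id x)
      map_comp := fun v w => by
        ext z; induction z using LextObj.ind with
        | h c x s => exact congrArg (LextObj.mk · s) (Het.pull_comp x v.unop w.unop) }
  map {X Y} φ :=
    { app := fun d => ↾(LextObj.lift (fun c x s => LextObj.mk x (φ.app (op c) s))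
        (fun {c c'} f x s => by
          rw [← LextObj.sound f x, NatTrans.naturality_apply]))
      naturality := fun d d' v => by
        ext z; induction z using LextObj.ind with
        | h c x s => rfl }
  map_id X := by
    ext d z; induction z using LextObj.ind with
    | h c x s => rfl
  map_comp φ ψ := by
    ext d z; induction z using LextObj.ind with
    | h c x s => rfl

/-- The transformation `lext_H ⟶ lext_{H'}` induced by a transformation of distributors. -/
def lextMap {H H' : Profunctor.{u} C D} (φ : H ⟶ H') : lext H ⟶ lext H' where
  app X :=
    { app := fun d => ↾(LextObj.lift (fun c x s => LextObj.mk ((φ.app c).app d x) s)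
        (fun {c c'} f x s => by
          rw [LextObj.sound]
          congr 1
          exact (ConcreteCategory.congr_hom (NatTrans.congr_app (φ.naturality f) d) x).symm))
      naturality := fun d d' v => by
        ext z; induction z using LextObj.ind with
        | h c x s => exact congrArg (LextObj.mk · s) (NatTrans.naturality_apply (φ.app c) v x) }
  naturality X Y ψ := by
    ext d z; induction z using LextObj.ind with
    | h c x s => rfl

/-- The composite distributor `G ⊗ H : B ⇸ D` of `H : B ⇸ C` and `G : C ⇸ D`, with
`(G ⊗ H)(d, b) = ∫^c H(c, b) × G(d, c)`. -/
def tensor (G : Profunctor.{u} C D) (H : Profunctor.{u} B C) : Profunctor.{u} B D := H ⋙ lext G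

/-- `lext_H` for the unit distributor `hom_C`. -/
def lextUnit (C : Type u) [SmallCategory C] : lext (Profunctor.id (C := C)) ≅ 𝟭 (Cᵒᵖ ⥤ Type u) where
  hom :=
    { app := fun X =>
        { app := fun d => ↾(LextObj.lift (fun c (x : d.unop ⟶ c) s => X.map x.op s)
            (fun f x s => by
              exact (ConcreteCategory.congr_hom (X.map_comp f.op (Quiver.Hom.op x)) s).symm))
          naturality := fun d d' v => by
            ext z; induction z using LextObj.ind with
            | h c x s =>
              exact ConcreteCategory.congr_hom (X.map_comp (Quiver.Hom.op x) v) s }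
      naturality := fun X Y φ => by
        ext d z; induction z using LextObj.ind with
        | h c x s => exact (NatTrans.naturality_apply φ (Quiver.Hom.op x) s).symm }
  inv :=
    { app := fun X =>
        { app := fun d => ↾(fun s => LextObj.mk (H := Profunctor.id) (𝟙 d.unop) s)
          naturality := fun d d' v => by
            ext s
            change LextObj.mk (H := Profunctor.id) (𝟙 d'.unop) (X.map v s) =
              LextObj.mk (H := Profunctor.id) (v.unop ≫ 𝟙 d.unop) s
            refine (LextObj.sound (H := Profunctor.id) v.unop (𝟙 d'.unop) s).trans ?_
            congr 1
            change 𝟙 _ ≫ v.unop = _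
            simp }
      naturality := fun X Y φ => by ext d z; rfl }
  hom_inv_id := by
    ext X d z; induction z using LextObj.ind with
    | h c x s =>
      refine (LextObj.sound (H := Profunctor.id) x (𝟙 d.unop) s).trans ?_
      congr 1
      exact Category.id_comp (obj := C) x
  inv_hom_id := by
    ext X d s
    change X.map (𝟙 d) s = s
    simp

/-- `lext_G ∘ lext_H ≅ lext_{G ⊗ H}`. -/
def lextTensor (G : Profunctor.{u} C D) (H : Profunctor.{u} B C) :
    lext H ⋙ lext G ≅ lext (tensor G H) where
  hom :=
    { app := fun X =>
        { app := fun d => ↾(LextObj.lift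
            (fun c y z => LextObj.lift
              (fun b x s => LextObj.mk (H := tensor G H) (LextObj.mk (X := H.obj b) y x) s)
              (fun f x s => LextObj.sound (H := tensor G H) f (LextObj.mk y x) s) z)
            (fun f y z => by
              induction z using LextObj.ind with
              | h b x s =>
                exact congrArg (LextObj.mk (H := tensor G H) · s)
                  (LextObj.sound (X := H.obj b) f y x)))
          naturality := fun d d' v => by
            ext z; induction z using LextObj.ind with
            | h c y z => induction z using LextObj.ind with
              | h b x s => rfl }
      naturality := fun X Y φ => by
        ext d z; induction z using LextObj.ind with
        | h c y z => induction z using LextObj.ind with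
          | h b x s => rfl }
  inv :=
    { app := fun X =>
        { app := fun d => ↾(LextObj.lift (H := tensor G H)
            (fun b w s => LextObj.lift (X := H.obj b)
              (fun c y x => LextObj.mk (X := (lext H).obj X) y (LextObj.mk x s))
              (fun f y x => LextObj.sound (X := (lext H).obj X) f y (LextObj.mk x s)) w)
            (fun f w s => by
              induction w using LextObj.ind with
              | h c y x =>
                exact congrArg (LextObj.mk (X := (lext H).obj X) y)
                  (LextObj.sound f x s)))
          naturality := fun d d' v => by
            ext z; induction z using LextObj.ind with
            | h b w s => induction w using LextObj.ind with
              | h c y x => rfl }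
      naturality := fun X Y φ => by
        ext d z; induction z using LextObj.ind with
        | h b w s => induction w using LextObj.ind with
          | h c y x => rfl }
  hom_inv_id := by
    ext X d z; induction z using LextObj.ind with
    | h c y z => induction z using LextObj.ind with
      | h b x s => rfl
  inv_hom_id := by
    ext X d z; induction z using LextObj.ind with
    | h b w s => induction w using LextObj.ind with
      | h c y x => rfl

/-- The left unit law `H ⊗ hom ≅ H` for the tensor product of distributors. -/
def tensorUnit (H : Profunctor.{u} C D) : tensor H Profunctor.id ≅ H :=
  NatIso.ofComponents (fun c => NatIso.ofComponents (fun d =>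
    { hom := ↾(LextObj.lift (H := H) (X := yoneda.obj c) (fun _ x f => Het.push x f)
        (fun f x g => Het.push_comp x f g))
      inv := ↾(fun x => LextObj.mk (H := H) (X := yoneda.obj c) x (𝟙 c))
      hom_inv_id := by
        ext z; induction z using LextObj.ind with
        | h c' x f =>
          refine (LextObj.sound (X := yoneda.obj c) f x (𝟙 c)).symm.trans ?_
          exact congrArg (LextObj.mk (X := yoneda.obj c) x) (Category.comp_id (obj := C) f)
      inv_hom_id := by
        ext x; exact Het.push_id x })
    (fun {d d'} v => by
      ext z; induction z using LextObj.ind with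
      | h c' x f => exact (Het.push_pull x f v.unop).symm))
    (fun {c c'} g => by
      ext d z; induction z using LextObj.ind with
      | h c'' x f => exact Het.push_comp x f g)

end Distributors
section Sites

variable {B C D : Type u} [SmallCategory B] [SmallCategory C] [SmallCategory D]

/-- For `x ∈ H(d, c)` and a sieve `S` on `c`, the sieve `x^* H[S]` on `d` of those `v : d' ⟶ d` such
that `H(v, c)(x) = H(d', f)(x')` for some `f : c' ⟶ c` in `S` and some `x' ∈ H(d', c')`. -/
def pullSieve (H : Profunctor.{u} C D) {d : D} {c : C} (x : Het H d c) (S : Sieve c) : Sieve d where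
  arrows d' v := ∃ (c' : C) (f : c' ⟶ c) (_ : S f) (x' : Het H d' c'), x'.push f = x.pull v
  downward_closed := by
    rintro _ _ v ⟨c', f, hf, x', h⟩ w
    exact ⟨c', f, hf, x'.pull w, by rw [← Het.push_pull, h, Het.pull_comp]⟩

/-- A distributor `H : C ⇸ D` is cover-distributing from `J` to `K` if `x^* H[S]` is `K`-covering
for every heteromorphism `x ∈ H(d, c)` and every `J`-covering sieve `S` on `c`. -/
def IsCoverDistributing (J : GrothendieckTopology C) (K : GrothendieckTopology D)
    (H : Profunctor.{u} C D) : Prop :=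
  ∀ ⦃d : D⦄ ⦃c : C⦄ (x : Het H d c) (S : Sieve c), S ∈ J c → pullSieve H x S ∈ K d

/-- The sieve of those `v : d' ⟶ d` such that `H(d', c)` is inhabited for some `c`. -/
def inhabSieve (H : Profunctor.{u} C D) (d : D) : Sieve d where
  arrows d' _ := ∃ c : C, Nonempty (Het H d' c)
  downward_closed := by
    rintro _ _ v ⟨c, ⟨x⟩⟩ w
    exact ⟨c, ⟨x.pull w⟩⟩

/-- For `x ∈ H(d, c)` and `x' ∈ H(d, c')`, the sieve of those `v : d' ⟶ d` such that
`H(v, c)(x)` and `H(v, c')(x')` both factor through a common `x'' ∈ H(d', c'')` along a span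
`c ⟵ c'' ⟶ c'`. -/
def spanSieve (H : Profunctor.{u} C D) {d : D} {c c' : C} (x : Het H d c) (x' : Het H d c') :
    Sieve d where
  arrows d' v := ∃ (c'' : C) (f : c'' ⟶ c) (f' : c'' ⟶ c') (x'' : Het H d' c''),
    x''.push f = x.pull v ∧ x''.push f' = x'.pull v
  downward_closed := by
    rintro _ _ v ⟨c'', f, f', x'', h, h'⟩ w
    exact ⟨c'', f, f', x''.pull w, by rw [← Het.push_pull, h, Het.pull_comp],
      by rw [← Het.push_pull, h', Het.pull_comp]⟩

/-- For `f, f' : c' ⟶ c` and `x ∈ H(d, c')`, the sieve of those `v : d' ⟶ d` such that `H(v, c')(x)`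
factors through some `x' ∈ H(d', c'')` along some `g : c'' ⟶ c'` equalizing `f` and `f'`. -/
def eqSieve (H : Profunctor.{u} C D) {d : D} {c c' : C} (f f' : c' ⟶ c) (x : Het H d c') :
    Sieve d where
  arrows d' v := ∃ (c'' : C) (g : c'' ⟶ c') (x' : Het H d' c''),
    g ≫ f = g ≫ f' ∧ x'.push g = x.pull v
  downward_closed := by
    rintro _ _ v ⟨c'', g, x', h, h'⟩ w
    exact ⟨c'', g, x'.pull w, h, by rw [← Het.push_pull, h', Het.pull_comp]⟩

/-- `K`-flatness of a distributor `H : C ⇸ D`, for a topology `K` on `D`. -/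
structure IsFlatDistributor (K : GrothendieckTopology D) (H : Profunctor.{u} C D) : Prop where
  inhab (d : D) : inhabSieve H d ∈ K d
  span {d : D} {c c' : C} (x : Het H d c) (x' : Het H d c') : spanSieve H x x' ∈ K d
  eq {d : D} {c c' : C} (f f' : c' ⟶ c) (x : Het H d c') (h : x.push f = x.push f') :
    eqSieve H f f' x ∈ K d

/-- A distributor of sites `(C, J) ⇸ (D, K)`. -/
structure IsDistributorOfSites (J : GrothendieckTopology C) (K : GrothendieckTopology D)
    (H : Profunctor.{u} C D) : Prop where
  coverDistributing : IsCoverDistributing J K H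
  flat : IsFlatDistributor K H

/-- For `x ∈ H(d, c)`, `s ∈ X(c)` and `x' ∈ H(d, c')`, `s' ∈ X(c')`, the sieve of those `v` along
which `(c, x, s)` and `(c', x', s')` are identified by a span `c ⟵ c'' ⟶ c'`. -/
def glueSieve {H : Profunctor.{u} C D} {X : Cᵒᵖ ⥤ Type u} {d : D} (p q : LextPre H X d) :
    Sieve d where
  arrows d' v := ∃ (c'' : C) (f : c'' ⟶ p.c) (f' : c'' ⟶ q.c) (x'' : Het H d' c''),
    x''.push f = p.x.pull v ∧ x''.push f' = q.x.pull v ∧ X.map f.op p.s = X.map f'.op q.s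
  downward_closed := by
    rintro _ _ v ⟨c'', f, f', x'', h, h', e⟩ w
    exact ⟨c'', f, f', x''.pull w, by rw [← Het.push_pull, h, Het.pull_comp],
      by rw [← Het.push_pull, h', Het.pull_comp], e⟩

lemma mem_of_local {K : GrothendieckTopology D} {d : D} {S R : Sieve d} (hS : S ∈ K d)
    (h : ∀ ⦃d' : D⦄ (v : d' ⟶ d), S v → ∃ T ∈ K d', ∀ ⦃d'' : D⦄ (w : d'' ⟶ d'), T w → R (w ≫ v)) :
    R ∈ K d :=
  K.transitive hS R fun d' v hv => by
    obtain ⟨T, hT, hTR⟩ := h v hv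
    exact K.superset_covering (fun d'' w hw => hTR w hw) hT

section

variable {K : GrothendieckTopology D} {H : Profunctor.{u} C D}

/-- A common refinement for two heteromorphisms which become equal after pushing forward. -/
lemma IsFlatDistributor.cospan (hH : IsFlatDistributor K H) {d : D} {c₁ c₂ c : C} (x₁ : Het H d c₁)
    (x₂ : Het H d c₂) (g₁ : c₁ ⟶ c) (g₂ : c₂ ⟶ c) (e : x₁.push g₁ = x₂.push g₂) :
    ∃ T ∈ K d, ∀ ⦃d' : D⦄ (v : d' ⟶ d), T v → ∃ (c₃ : C) (h₁ : c₃ ⟶ c₁) (h₂ : c₃ ⟶ c₂)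
      (x₃ : Het H d' c₃), x₃.push h₁ = x₁.pull v ∧ x₃.push h₂ = x₂.pull v ∧
        h₁ ≫ g₁ = h₂ ≫ g₂ := by
  let R : Sieve d :=
    { arrows := fun d' v => ∃ (c₃ : C) (h₁ : c₃ ⟶ c₁) (h₂ : c₃ ⟶ c₂)
        (x₃ : Het H d' c₃), x₃.push h₁ = x₁.pull v ∧ x₃.push h₂ = x₂.pull v ∧ h₁ ≫ g₁ = h₂ ≫ g₂
      downward_closed := by
        rintro _ _ v ⟨c'', f, f', x'', h, h', e⟩ w
        exact ⟨c'', f, f', x''.pull w, by rw [← Het.push_pull, h, Het.pull_comp],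
          by rw [← Het.push_pull, h', Het.pull_comp], e⟩ }
  refine ⟨R, mem_of_local (hH.span x₁ x₂) ?_, fun d' v h => h⟩
  rintro d' v ⟨c₃, h₁, h₂, x₃, e₁, e₂⟩
  refine ⟨_, hH.eq (h₁ ≫ g₁) (h₂ ≫ g₂) x₃ ?_, ?_⟩
  · rw [Het.push_comp, Het.push_comp, e₁, e₂, ← Het.push_pull, ← Het.push_pull, e]
  · rintro d'' w ⟨c₄, k, x₄, e₃, e₄⟩
    refine ⟨c₄, k ≫ h₁, k ≫ h₂, x₄, ?_, ?_, by simpa using e₃⟩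
    · rw [Het.push_comp, e₄, Het.pull_comp, ← e₁, Het.push_pull]
    · rw [Het.push_comp, e₄, Het.pull_comp, ← e₂, Het.push_pull]

lemma IsFlatDistributor.glueSieve_mem (hH : IsFlatDistributor K H) {X : Cᵒᵖ ⥤ Type u} {d : D}
    {c c' : C} (x : Het H d c) (s : X.obj (op c)) (x' : Het H d c') (s' : X.obj (op c'))
    (e : LextObj.mk x s = LextObj.mk x' s') :
    glueSieve (X := X) ⟨c, x, s⟩ ⟨c', x', s'⟩ ∈ K d := by
  have key : ∀ p q : LextPre H X d, Relation.EqvGen (LextRel H X d) p q → glueSieve p q ∈ K d := by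
    intro p q hpq
    induction hpq with
    | rel p q hpq =>
      obtain ⟨f, x, s⟩ := hpq
      refine K.superset_covering (fun d' v _ => ?_) (K.top_mem d)
      exact ⟨_, 𝟙 _, f, x.pull v, Het.push_id _, (Het.push_pull _ _ _).symm, by simp⟩
    | refl p =>
      refine K.superset_covering (fun d' v _ => ?_) (K.top_mem d)
      exact ⟨_, 𝟙 _, 𝟙 _, p.x.pull v, Het.push_id _, Het.push_id _, rfl⟩
    | symm p q _ ih =>
      refine K.superset_covering (fun d' v hv => ?_) ih
      obtain ⟨c'', f, f', x'', h, h', e⟩ := hv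
      exact ⟨c'', f', f, x'', h', h, e.symm⟩
    | trans p q r _ _ ih₁ ih₂ =>
      refine mem_of_local (K.intersection_covering ih₁ ih₂) ?_
      rintro d' v ⟨⟨c₁, f₁, g₁, x₁, h₁, h₁', e₁⟩, ⟨c₂, f₂, g₂, x₂, h₂, h₂', e₂⟩⟩
      obtain ⟨T, hT, hT'⟩ := hH.cospan x₁ x₂ g₁ f₂ (h₁'.trans h₂.symm)
      refine ⟨T, hT, fun d'' w hw => ?_⟩
      obtain ⟨c₃, k₁, k₂, x₃, i₁, i₂, i₃⟩ := hT' w hw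
      refine ⟨c₃, k₁ ≫ f₁, k₂ ≫ g₂, x₃, ?_, ?_, ?_⟩
      · rw [Het.push_comp, i₁, ← Het.push_pull, h₁, Het.pull_comp]
      · rw [Het.push_comp, i₂, ← Het.push_pull, h₂', Het.pull_comp]
      · have i₄ := congrArg (fun t => X.map (Quiver.Hom.op t) q.s) i₃
        simp only [op_comp, Functor.map_comp, ConcreteCategory.comp_apply] at i₄ ⊢
        rw [e₁, i₄, e₂]
  exact key _ _ (Quot.eqvGen_exact e)

end

/-- The unit distributor of a site is a distributor of sites. -/
lemma isDistributorOfSites_id (J : GrothendieckTopology C) :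
    IsDistributorOfSites J J (Profunctor.id (C := C)) where
  coverDistributing d c x S hS := by
    refine J.superset_covering (fun d' v hv => ?_) (J.pullback_stable (X := c) (Y := d) x hS)
    exact ⟨d', _, hv, 𝟙 d', Category.id_comp (obj := C) _⟩
  flat :=
    { inhab := fun d => by
        refine J.superset_covering (fun d' v _ => ?_) (J.top_mem d)
        exact ⟨d', ⟨𝟙 d'⟩⟩
      span := fun {d c c'} x x' => by
        refine J.superset_covering (fun d' v _ => ?_) (J.top_mem d)
        exact ⟨d', v ≫ (show d ⟶ c from x), v ≫ (show d ⟶ c' from x'), 𝟙 d',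
          Category.id_comp (obj := C) _, Category.id_comp (obj := C) _⟩
      eq := fun {d c c'} f f' x h => by
        refine J.superset_covering (fun d' v _ => ?_) (J.top_mem d)
        refine ⟨d', v ≫ (show d ⟶ c' from x), 𝟙 d', ?_, Category.id_comp (obj := C) _⟩
        rw [Category.assoc, Category.assoc]
        exact congrArg (v ≫ ·) h }

/-- Distributors of sites are closed under composition. -/
lemma IsDistributorOfSites.tensor {I : GrothendieckTopology B} {J : GrothendieckTopology C}
    {K : GrothendieckTopology D} {G : Profunctor.{u} C D} {H : Profunctor.{u} B C}
    (hG : IsDistributorOfSites J K G) (hH : IsDistributorOfSites I J H) :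
    IsDistributorOfSites I K (tensor G H) where
  coverDistributing d b z S hS := by
    induction z using LextObj.ind with
    | h c y x =>
      refine K.superset_covering (fun d' v hv => ?_)
        (hG.coverDistributing y _ (hH.coverDistributing x S hS))
      obtain ⟨c', f, ⟨b', g, hg, x', e⟩, y', e'⟩ := hv
      refine ⟨b', g, hg, LextObj.mk y' x', ?_⟩
      change LextObj.mk y' (x'.push g) = LextObj.mk (X := H.obj b) (y.pull v) x
      rw [e, ← e']
      exact LextObj.sound f y' x
  flat :=
    { inhab := fun d => by
        refine mem_of_local (hG.flat.inhab d) ?_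
        rintro d' v ⟨c, ⟨y⟩⟩
        refine ⟨_, hG.coverDistributing y _ (hH.flat.inhab c), ?_⟩
        rintro d'' w ⟨c', f, ⟨b, ⟨x⟩⟩, y', -⟩
        exact ⟨b, ⟨LextObj.mk y' x⟩⟩
      span := fun {d b b'} z z' => by
        induction z using LextObj.ind with
        | h c y x =>
        induction z' using LextObj.ind with
        | h c' y' x' =>
        change Het H c b at x
        change Het H c' b' at x'
        refine mem_of_local (hG.flat.span y y') ?_
        rintro d' v ⟨c'', f, f', y'', h, h'⟩
        refine ⟨_, hG.coverDistributing y'' _ (hH.flat.span (x.pull f) (x'.pull f')), ?_⟩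
        rintro d'' w ⟨c₃, g, ⟨b₃, k, k', x₃, i, i'⟩, y₃, j⟩
        refine ⟨b₃, k, k', LextObj.mk y₃ x₃, ?_, ?_⟩
        · change LextObj.mk y₃ (x₃.push k) = LextObj.mk (X := H.obj b) (y.pull (w ≫ v)) x
          rw [i, Het.pull_comp, ← h, Het.push_pull, ← j, ← Het.push_comp, ← Het.pull_comp]
          exact LextObj.sound (g ≫ f) y₃ x
        · change LextObj.mk y₃ (x₃.push k') = LextObj.mk (X := H.obj b') (y'.pull (w ≫ v)) x'
          rw [i', Het.pull_comp, ← h', Het.push_pull, ← j, ← Het.push_comp, ← Het.pull_comp]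
          exact LextObj.sound (g ≫ f') y₃ x'
      eq := fun {d b' b} t t' z h => by
        induction z using LextObj.ind with
        | h c y x =>
        change Het H c b at x
        refine mem_of_local (hG.flat.glueSieve_mem (X := H.obj b') y (x.push t) y (x.push t') h) ?_
        rintro d' v ⟨c'', f, f', y'', h, h', e⟩
        refine ⟨Sieve.pullback v (eqSieve (SiteDistributors.tensor G H) t t' (LextObj.mk y x)),
          mem_of_local (hG.flat.eq f f' y'' (h.trans h'.symm)) ?_, fun _ _ hw => hw⟩
        rintro d'' w ⟨c₃, g, y₃, i, i'⟩
        have hx : (x.pull (g ≫ f)).push t = (x.pull (g ≫ f)).push t' := by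
          rw [← Het.push_pull, ← Het.push_pull, Het.pull_comp]
          change Het.pull ((H.obj b').map f.op (x.push t)) g = _
          rw [e, i, Het.pull_comp]
        refine ⟨_, hG.coverDistributing y₃ _ (hH.flat.eq t t' (x.pull (g ≫ f)) hx), ?_⟩
        rintro d₃ w' ⟨c₄, k, ⟨b₄, r, x₄, j, j'⟩, y₄, l⟩
        refine ⟨b₄, r, LextObj.mk y₄ x₄, j, ?_⟩
        change LextObj.mk y₄ (x₄.push r) = LextObj.mk (X := H.obj b) (y.pull ((w' ≫ w) ≫ v)) x
        have hy : y.pull ((w' ≫ w) ≫ v) = y₄.push (k ≫ g ≫ f) := by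
          have h₁ : y''.push f = y.pull v := h
          rw [Het.push_comp, l, Het.push_comp, ← Het.push_pull, i', ← Het.push_pull,
            ← Het.push_pull, h₁, ← Het.pull_comp, ← Het.pull_comp, Category.assoc]
        have hx' : x₄.push r = x.pull (k ≫ g ≫ f) := by rw [j', ← Het.pull_comp]
        rw [hx', hy]
        exact LextObj.sound (k ≫ g ≫ f) y₄ x }

end Sites

section Extension

open Limits

variable {C D : Type u} [SmallCategory C] [SmallCategory D]

/-- The restriction `rest_H : PSh(D) ⥤ PSh(C)` along a distributor `H : C ⇸ D`, given by
`rest_H(Y)(c) = Hom(H(-, c), Y)`. -/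
def rest (H : Profunctor.{u} C D) : (Dᵒᵖ ⥤ Type u) ⥤ (Cᵒᵖ ⥤ Type u) where
  obj Y := Functor.op H ⋙ yoneda.obj Y
  map g := Functor.whiskerLeft (Functor.op H) (yoneda.map g)

/-- The adjunction `lext_H ⊣ rest_H`. -/
def lextAdj (H : Profunctor.{u} C D) : lext H ⊣ rest H :=
  Adjunction.mkOfHomEquiv
    { homEquiv := fun X Y =>
        { toFun := fun α =>
            { app := fun c => ↾(fun s =>
                { app := fun d => ↾(fun x : Het H d.unop c.unop =>
                    α.app d (LextObj.mk (H := H) (X := X) x s))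
                  naturality := fun d d' v => by
                    ext x
                    exact NatTrans.naturality_apply α v (LextObj.mk (H := H) (X := X) x s) } )
              naturality := fun c c' f => by
                ext s
                refine NatTrans.ext (funext fun d => ?_)
                ext x
                exact congrArg (fun z : LextObj H X d.unop => α.app d z)
                  (LextObj.sound (H := H) (X := X) f.unop x s) }
          invFun := fun β =>
            { app := fun d => ↾(LextObj.lift (fun c x s =>
                (show H.obj c ⟶ Y from β.app (op c) s).app d x)
                (fun {c c'} f x s => by
                  exact ConcreteCategory.congr_hom (NatTrans.congr_app
                    (NatTrans.naturality_apply β f.op s) d) x))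
              naturality := fun d d' v => by
                ext z; induction z using LextObj.ind with
                | h c x s =>
                  exact NatTrans.naturality_apply (show H.obj c ⟶ Y from β.app (op c) s) v x }
          left_inv := fun α => by
            ext d z; induction z using LextObj.ind with
            | h c x s => rfl
          right_inv := fun β => by
            ext c s; rfl }
      homEquiv_naturality_left_symm := fun f g => by
        ext d z; induction z using LextObj.ind with
        | h c x s => rfl
      homEquiv_naturality_right := fun f g => by
        ext c s; rfl }

variable {J : GrothendieckTopology C} {K : GrothendieckTopology D} {H : Profunctor.{u} C D}

/-- For a distributor of sites, `lext_H` sends covering sieves to `K`-local isomorphisms. -/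
lemma IsDistributorOfSites.W_lext_map (hH : IsDistributorOfSites J K H) {c : C} (S : Sieve c)
    (hS : S ∈ J c) : K.W ((lext H).map S.functorInclusion) := by
  rw [GrothendieckTopology.W_iff_isLocallyBijective]
  constructor
  · constructor
    intro d z z' h
    induction z using LextObj.ind with
    | h c₁ x₁ s₁ =>
    induction z' using LextObj.ind with
    | h c₂ x₂ s₂ =>
    refine K.superset_covering ?_
      (hH.flat.glueSieve_mem (X := yoneda.obj c) x₁ s₁.1 x₂ s₂.1 h)
    rintro d' v ⟨c₃, f, f', x, e, e', e''⟩
    change LextObj.mk (x₁.pull v) s₁ = LextObj.mk (x₂.pull v) s₂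
    dsimp only at e e'
    rw [← e, ← e', ← LextObj.sound, ← LextObj.sound]
    exact congrArg (LextObj.mk (X := S.functor) x) (Subtype.ext e'')
  · constructor
    intro d z
    induction z using LextObj.ind with
    | h c₁ x₁ s₁ =>
    refine K.superset_covering ?_ (hH.coverDistributing (x₁.push (show c₁ ⟶ c from s₁)) S hS)
    rintro d' v ⟨c₂, f, hf, x₂, e⟩
    refine ⟨LextObj.mk (X := S.functor) x₂ ⟨f, hf⟩, ?_⟩
    change LextObj.mk (X := yoneda.obj c) x₂ f = LextObj.mk (X := yoneda.obj c) (x₁.pull v) s₁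
    have h₁ := LextObj.sound (X := yoneda.obj c) f x₂ (𝟙 c)
    have h₂ := LextObj.sound (X := yoneda.obj c) (show c₁ ⟶ c from s₁) (x₁.pull v) (𝟙 c)
    rw [← Het.push_pull, ← e, ← h₁] at h₂
    refine Eq.trans ?_ (h₂.symm.trans ?_)
    · exact congrArg (LextObj.mk (X := yoneda.obj c) x₂) (Category.comp_id (obj := C) f).symm
    · exact congrArg (LextObj.mk (X := yoneda.obj c) (x₁.pull v))
        (Category.comp_id (obj := C) (show c₁ ⟶ c from s₁))

/-- For a distributor of sites, `rest_H` sends `K`-sheaves to `J`-sheaves. -/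
lemma IsDistributorOfSites.isSheaf_rest (hH : IsDistributorOfSites J K H) (Y : Sheaf K (Type u)) :
    Presheaf.IsSheaf J ((rest H).obj Y.obj) := by
  rw [isSheaf_iff_isSheaf_of_type]
  intro c S hS
  rw [Presieve.isSheafFor_iff_yonedaSheafCondition]
  have hb := ((lextAdj H).map_comp_bijective_iff S.functorInclusion Y.obj).1
    (hH.W_lext_map S hS Y.obj Y.property)
  exact Function.bijective_iff_existsUnique _ |>.1 hb

lemma limit_elem_ext {I : Type} [SmallCategory I] (F : I ⥤ Cᵒᵖ ⥤ Type u) {c : Cᵒᵖ}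
    (s s' : (limit F).obj c) (h : ∀ i, (limit.π F i).app c s = (limit.π F i).app c s') : s = s' :=
  Concrete.isLimit_ext _ (isLimitOfPreserves ((evaluation _ _).obj c) (limit.isLimit F)) s s' h

lemma limit_elem_exists {I : Type} [SmallCategory I] (F : I ⥤ Cᵒᵖ ⥤ Type u) {c : Cᵒᵖ}
    (t : ∀ i, (F.obj i).obj c) (h : ∀ {i j : I} (m : i ⟶ j), (F.map m).app c (t i) = t j) :
    ∃ s : (limit F).obj c, ∀ i, (limit.π F i).app c s = t i :=
  ((Types.isLimit_iff _).1
    ⟨isLimitOfPreserves ((evaluation _ _).obj c) (limit.isLimit F)⟩ t (fun m => h m)).exists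

lemma limit_elem_w {I : Type} [SmallCategory I] (F : I ⥤ Cᵒᵖ ⥤ Type u) {c : Cᵒᵖ}
    (s : (limit F).obj c) {i j : I} (m : i ⟶ j) :
    (F.map m).app c ((limit.π F i).app c s) = (limit.π F j).app c s :=
  ConcreteCategory.congr_hom (NatTrans.congr_app (limit.w F m) c) s

/-- `a_K ∘ lext_H` preserves limits of a shape if the comparison maps are `K`-locally bijective. -/
lemma preservesLimitsOfShape_of_local (I : Type) [SmallCategory I]
    [FinCategory I] (hinj : ∀ (F : I ⥤ Cᵒᵖ ⥤ Type u) (d : D) (z z' : LextObj H (limit F) d),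
      (∀ i, ((lext H).map (limit.π F i)).app (op d) z = ((lext H).map (limit.π F i)).app (op d) z') →
      Presheaf.equalizerSieve (F := (lext H).obj (limit F)) (X := op d) z z' ∈ K d)
    (hsurj : ∀ (F : I ⥤ Cᵒᵖ ⥤ Type u) (d : D) (y : ∀ i, LextObj H (F.obj i) d),
      (∀ {i j : I} (m : i ⟶ j), ((lext H).map (F.map m)).app (op d) (y i) = y j) →
      ∃ T ∈ K d, ∀ ⦃d' : D⦄ (v : d' ⟶ d), T v → ∃ z : LextObj H (limit F) d', ∀ i,
        ((lext H).map (limit.π F i)).app (op d') z = ((lext H).obj (F.obj i)).map v.op (y i)) :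
    PreservesLimitsOfShape I (lext H ⋙ presheafToSheaf K (Type u)) := by
  refine ⟨fun {F} => preservesLimit_of_preserves_limit_cone (limit.isLimit F) ?_⟩
  have hW : K.W (limit.post F (lext H)) := by
    have hpost : ∀ (i : I) (d : Dᵒᵖ) (z : LextObj H (limit F) d.unop),
        (limit.π (F ⋙ lext H) i).app d ((limit.post F (lext H)).app d z) =
          ((lext H).map (limit.π F i)).app d z := fun i d z =>
      ConcreteCategory.congr_hom (NatTrans.congr_app (limit.post_π F (lext H) i) d) z
    rw [GrothendieckTopology.W_iff_isLocallyBijective]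
    constructor
    · constructor
      intro d z z' h
      refine hinj F d.unop z z' fun i => ?_
      exact (hpost i d z).symm.trans ((congrArg _ h).trans (hpost i d z'))
    · constructor
      intro d s
      obtain ⟨T, hT, hT'⟩ := hsurj F d (fun i => (limit.π (F ⋙ lext H) i).app (op d) s)
        (fun m => limit_elem_w (F ⋙ lext H) s m)
      refine K.superset_covering (fun d' v hv => ?_) hT
      obtain ⟨z, hz⟩ := hT' v hv
      refine ⟨z, limit_elem_ext (F ⋙ lext H) _ _ fun i => ?_⟩
      refine (hpost i (op d') z).trans ((hz i).trans ?_)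
      exact (NatTrans.naturality_apply (limit.π (F ⋙ lext H) i) v.op s).symm
  rw [GrothendieckTopology.W_iff] at hW
  refine IsLimit.ofIsoLimit
    (isLimitOfPreserves (presheafToSheaf K (Type u)) (limit.isLimit (F ⋙ lext H)))
    (Cone.ext (asIso ((presheafToSheaf K (Type u)).map (limit.post F (lext H)))) (fun i => ?_)).symm
  change (presheafToSheaf K (Type u)).map _ = (presheafToSheaf K (Type u)).map _ ≫
    (presheafToSheaf K (Type u)).map _
  rw [← Functor.map_comp]
  exact congrArg _ (limit.post_π F (lext H) i).symm

/-- For a `K`-flat distributor `H`, the functor `a_K ∘ lext_H` is left exact. -/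
lemma IsFlatDistributor.preservesFiniteLimits (hH : IsFlatDistributor K H) :
    PreservesFiniteLimits (lext H ⋙ presheafToSheaf K (Type u)) := by
  have h₁ : PreservesLimitsOfShape (Discrete.{0} PEmpty)
      (lext H ⋙ presheafToSheaf K (Type u)) := by
    refine preservesLimitsOfShape_of_local _ ?_ ?_
    · intro F d z z' _
      induction z using LextObj.ind with
      | h c x s =>
      induction z' using LextObj.ind with
      | h c' x' s' =>
      refine K.superset_covering ?_ (hH.span x x')
      rintro d' v ⟨c'', f, f', x'', e, e'⟩
      change LextObj.mk (x.pull v) s = LextObj.mk (x'.pull v) s'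
      rw [← e, ← e', ← LextObj.sound, ← LextObj.sound]
      congr 1
      exact limit_elem_ext F _ _ fun i => i.as.elim
    · intro F d y _
      refine ⟨_, hH.inhab d, ?_⟩
      rintro d' v ⟨c, ⟨x⟩⟩
      obtain ⟨s, -⟩ := limit_elem_exists F (c := op c) (fun i => i.as.elim) (fun {i} => i.as.elim)
      exact ⟨LextObj.mk x s, fun i => i.as.elim⟩
  have h₂ : PreservesLimitsOfShape WalkingCospan (lext H ⋙ presheafToSheaf K (Type u)) := by
    refine preservesLimitsOfShape_of_local _ ?_ ?_
    · intro F d z z' h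
      induction z using LextObj.ind with
      | h c x s =>
      induction z' using LextObj.ind with
      | h c' x' s' =>
      refine mem_of_local (K.intersection_covering
        (hH.glueSieve_mem x _ x' _ (h WalkingCospan.left))
        (hH.glueSieve_mem x _ x' _ (h WalkingCospan.right))) ?_
      rintro d' v ⟨⟨c₁, f₁, f₁', x₁, a₁, a₁', e₁⟩, ⟨c₂, f₂, f₂', x₂, a₂, a₂', e₂⟩⟩
      dsimp only at f₁ f₁' a₁ a₁' f₂ f₂' a₂ a₂' e₁ e₂
      obtain ⟨T, hT, hT'⟩ := hH.cospan x₁ x₂ f₁ f₂ (a₁.trans a₂.symm)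
      refine ⟨Sieve.pullback v (Presheaf.equalizerSieve (F := (lext H).obj (limit F)) (X := op d)
        (LextObj.mk x s) (LextObj.mk x' s')), mem_of_local hT ?_, fun _ _ hw => hw⟩
      intro d₂ w hw
      obtain ⟨c₃, k₁, k₂, x₃, b₁, b₂, b₃⟩ := hT' w hw
      refine ⟨_, hH.eq (k₁ ≫ f₁') (k₂ ≫ f₂') x₃ ?_, ?_⟩
      · rw [Het.push_comp, Het.push_comp, b₁, b₂, ← Het.push_pull, ← Het.push_pull, a₁', a₂']
      · rintro d₃ w' ⟨c₄, l, x₄, i₁, i₂⟩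
        change LextObj.mk (x.pull ((w' ≫ w) ≫ v)) s = LextObj.mk (x'.pull ((w' ≫ w) ≫ v)) s'
        have j₁ : x.pull ((w' ≫ w) ≫ v) = x₄.push (l ≫ k₁ ≫ f₁) := by
          rw [Het.push_comp, i₂, Het.push_comp, ← Het.push_pull, b₁, ← Het.push_pull,
            ← Het.push_pull, a₁, ← Het.pull_comp, ← Het.pull_comp, Category.assoc]
        have j₂ : x'.pull ((w' ≫ w) ≫ v) = x₄.push (l ≫ k₁ ≫ f₁') := by
          rw [Het.push_comp, i₂, Het.push_comp, ← Het.push_pull, b₁, ← Het.push_pull,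
            ← Het.push_pull, a₁', ← Het.pull_comp, ← Het.pull_comp, Category.assoc]
        rw [j₁, j₂, ← LextObj.sound, ← LextObj.sound]
        congr 1
        have hl : (limit.π F WalkingCospan.left).app (op c₄) ((limit F).map (l ≫ k₁ ≫ f₁).op s) =
            (limit.π F WalkingCospan.left).app (op c₄) ((limit F).map (l ≫ k₁ ≫ f₁').op s') := by
          rw [NatTrans.naturality_apply, NatTrans.naturality_apply]
          have := congrArg ((F.obj WalkingCospan.left).map (l ≫ k₁).op) e₁
          simpa using this
        have hr : (limit.π F WalkingCospan.right).app (op c₄) ((limit F).map (l ≫ k₁ ≫ f₁).op s) =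
            (limit.π F WalkingCospan.right).app (op c₄)
              ((limit F).map (l ≫ k₁ ≫ f₁').op s') := by
          rw [b₃, i₁, NatTrans.naturality_apply, NatTrans.naturality_apply]
          have := congrArg ((F.obj WalkingCospan.right).map (l ≫ k₂).op) e₂
          simpa using this
        refine limit_elem_ext F _ _ fun i => ?_
        match i with
        | some WalkingPair.left => exact hl
        | some WalkingPair.right => exact hr
        | none =>
          refine (limit_elem_w F _ WalkingCospan.Hom.inl).symm.trans
            (Eq.trans ?_ (limit_elem_w F _ WalkingCospan.Hom.inl))
          exact congrArg _ hl
    · intro F d y hy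
      obtain ⟨yl, hl⟩ : ∃ z, z = y WalkingCospan.left := ⟨_, rfl⟩
      obtain ⟨yr, hr⟩ : ∃ z, z = y WalkingCospan.right := ⟨_, rfl⟩
      have hyl := hy WalkingCospan.Hom.inl
      have hyr := hy WalkingCospan.Hom.inr
      rw [← hl] at hyl
      rw [← hr] at hyr
      induction yl using LextObj.ind with
      | h c₁ x₁ s₁ =>
      induction yr using LextObj.ind with
      | h c₂ x₂ s₂ =>
      refine ⟨_, hH.glueSieve_mem x₁ _ x₂ _ (hyl.trans hyr.symm), ?_⟩
      rintro d' v ⟨c, f₁, f₂, x, a₁, a₂, e⟩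
      dsimp only at f₁ f₂ a₁ a₂ e
      rw [← NatTrans.naturality_apply, ← NatTrans.naturality_apply] at e
      obtain ⟨s, hs⟩ := limit_elem_exists F (c := op c)
        (fun i => match i with
          | some WalkingPair.left => (F.obj WalkingCospan.left).map f₁.op s₁
          | some WalkingPair.right => (F.obj WalkingCospan.right).map f₂.op s₂
          | none => (F.map WalkingCospan.Hom.inl).app (op c)
              ((F.obj WalkingCospan.left).map f₁.op s₁))
        (fun {i j} (m : WidePullbackShape.Hom i j) => by
          cases m with
          | id i =>
            refine (ConcreteCategory.congr_hom (NatTrans.congr_app (F.map_id i) (op c)) _).trans ?_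
            rfl
          | term i => cases i with
            | left => rfl
            | right => exact e.symm)
      have key : ∀ i, ((lext H).map (limit.π F i)).app (op d') (LextObj.mk x s) =
          LextObj.mk x ((limit.π F i).app (op c) s) := fun i => rfl
      have kl : ((lext H).map (limit.π F WalkingCospan.left)).app (op d') (LextObj.mk x s) =
          ((lext H).obj (F.obj WalkingCospan.left)).map v.op (y WalkingCospan.left) := by
        rw [key, hs, ← hl]
        exact (LextObj.sound f₁ x s₁).trans (congrArg (LextObj.mk · s₁) a₁)
      refine ⟨LextObj.mk x s, fun i => ?_⟩
      match i with
      | some WalkingPair.left => exact kl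
      | some WalkingPair.right =>
        refine (key WalkingCospan.right).trans ?_
        rw [hs, ← hr]
        exact (LextObj.sound f₂ x s₂).trans (congrArg (LextObj.mk · s₂) a₂)
      | none =>
        have h₀ := hy WalkingCospan.Hom.inl
        have := congrArg (((lext H).map (F.map WalkingCospan.Hom.inl)).app (op d')) kl
        refine Eq.trans ?_ (this.trans ((NatTrans.naturality_apply
          ((lext H).map (F.map WalkingCospan.Hom.inl)) v.op (y WalkingCospan.left)).trans
            (congrArg _ h₀)))
        refine (key WalkingCospan.one).trans ?_
        exact congrArg (LextObj.mk x) (limit_elem_w F s WalkingCospan.Hom.inl).symm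
  exact preservesFiniteLimits_of_preservesTerminal_and_pullbacks _

end Extension

section Toposes

/-- A Grothendieck topos: a category equivalent to the category of sheaves of sets on a small
site. -/
structure GrothendieckTopos : Type (u + 2) where
  carrier : Type (u + 1)
  [category : Category.{u} carrier]
  isTopos : ∃ (C : Type u) (_ : SmallCategory C) (J : GrothendieckTopology C),
    Nonempty (carrier ≌ Sheaf J (Type u))

attribute [instance] GrothendieckTopos.category

/-- The topos of sheaves of sets on a small site. -/
def sheafTopos {C : Type u} [SmallCategory C] (J : GrothendieckTopology C) :
    GrothendieckTopos.{u} where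
  carrier := Sheaf J (Type u)
  isTopos := ⟨C, inferInstance, J, ⟨CategoryTheory.Equivalence.refl⟩⟩

/-- A geometric morphism `E ⟶ F`: an adjunction `inverse ⊣ direct` with `direct : E ⥤ F` and
`inverse : F ⥤ E` left exact. -/
structure GeomMorphism (E F : GrothendieckTopos.{u}) : Type (u + 1) where
  inverse : F.carrier ⥤ E.carrier
  direct : E.carrier ⥤ F.carrier
  adj : inverse ⊣ direct
  lex : Limits.PreservesFiniteLimits inverse

/-- Geometric transformations `f ⟶ g`: natural transformations `f^* ⟶ g^*` between inverse
images. -/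
@[ext]
structure GeomTransformation {E F : GrothendieckTopos.{u}} (f g : GeomMorphism E F) :
    Type (u + 1) where
  onInverse : f.inverse ⟶ g.inverse

instance : CategoryStruct GrothendieckTopos.{u} where
  Hom E F := GeomMorphism E F
  id E :=
    { inverse := 𝟭 _
      direct := 𝟭 _
      adj := Adjunction.id
      lex := inferInstance }
  comp f g :=
    { inverse := g.inverse ⋙ f.inverse
      direct := f.direct ⋙ g.direct
      adj := g.adj.comp f.adj
      lex := by
        have := f.lex
        have := g.lex
        exact Limits.comp_preservesFiniteLimits _ _ }

instance (E F : GrothendieckTopos.{u}) : Category (E ⟶ F) where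
  Hom f g := GeomTransformation f g
  id f := ⟨𝟙 _⟩
  comp η θ := ⟨η.onInverse ≫ θ.onInverse⟩

/-- An isomorphism between inverse images, as an invertible geometric transformation. -/
def geomIso {E F : GrothendieckTopos.{u}} {f g : E ⟶ F} (e : f.inverse ≅ g.inverse) : f ≅ g where
  hom := ⟨e.hom⟩
  inv := ⟨e.inv⟩
  hom_inv_id := GeomTransformation.ext e.hom_inv_id
  inv_hom_id := GeomTransformation.ext e.inv_hom_id

@[ext]
lemma geom_hom_ext {E F : GrothendieckTopos.{u}} {f g : E ⟶ F} {η θ : f ⟶ g}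
    (h : η.onInverse = θ.onInverse) : η = θ := GeomTransformation.ext h

@[simp] lemma onInverse_id {E F : GrothendieckTopos.{u}} (f : E ⟶ F) :
    GeomTransformation.onInverse (𝟙 f) = 𝟙 _ := rfl

@[simp] lemma onInverse_comp {E F : GrothendieckTopos.{u}} {f g h : E ⟶ F} (η : f ⟶ g)
    (θ : g ⟶ h) : (η ≫ θ).onInverse = η.onInverse ≫ θ.onInverse := rfl

/-- A transformation between inverse images, as a geometric transformation. -/
def geomMk {E F : GrothendieckTopos.{u}} {f g : E ⟶ F} (α : f.inverse ⟶ g.inverse) : f ⟶ g := ⟨α⟩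

@[simp] lemma onInverse_geomMk {E F : GrothendieckTopos.{u}} {f g : E ⟶ F}
    (α : f.inverse ⟶ g.inverse) : (geomMk α).onInverse = α := rfl

@[simp] lemma onInverse_geomIso_hom {E F : GrothendieckTopos.{u}} {f g : E ⟶ F}
    (e : f.inverse ≅ g.inverse) : (geomIso e).hom.onInverse = e.hom := rfl

@[simp] lemma onInverse_geomIso_inv {E F : GrothendieckTopos.{u}} {f g : E ⟶ F}
    (e : f.inverse ≅ g.inverse) : (geomIso e).inv.onInverse = e.inv := rfl

lemma inverse_comp {E F G : GrothendieckTopos.{u}} (f : E ⟶ F) (g : F ⟶ G) :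
    (f ≫ g).inverse = g.inverse ⋙ f.inverse := rfl

lemma inverse_id (E : GrothendieckTopos.{u}) : (𝟙 E : E ⟶ E).inverse = 𝟭 _ := rfl

/-- The bicategory `Top` of Grothendieck toposes, geometric morphisms and geometric
transformations. -/
instance : Bicategory GrothendieckTopos.{u} where
  homCategory := inferInstance
  whiskerLeft f _ _ η := geomMk (Functor.whiskerRight η.onInverse f.inverse)
  whiskerRight η h := geomMk (Functor.whiskerLeft h.inverse η.onInverse)
  associator f g h := geomIso (Functor.associator h.inverse g.inverse f.inverse).symm
  leftUnitor f := geomIso (f := 𝟙 _ ≫ f) (Functor.rightUnitor f.inverse)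
  rightUnitor f := geomIso (f := f ≫ 𝟙 _) (Functor.leftUnitor f.inverse)
  whiskerLeft_id := by intros; ext X; simp [inverse_comp, inverse_id]
  whiskerLeft_comp := by intros; ext X; simp [inverse_comp, inverse_id]
  id_whiskerLeft := by intros; ext X; simp [inverse_comp, inverse_id]
  comp_whiskerLeft := by intros; ext X; simp [inverse_comp, inverse_id]
  id_whiskerRight := by intros; ext X; simp [inverse_comp, inverse_id]
  comp_whiskerRight := by intros; ext X; simp [inverse_comp, inverse_id]
  whiskerRight_id := by intros; ext X; simp [inverse_comp, inverse_id]
  whiskerRight_comp := by intros; ext X; simp [inverse_comp, inverse_id]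
  whisker_assoc := by intros; ext X; simp [inverse_comp, inverse_id]
  whisker_exchange := by intros; ext X; simp [inverse_comp, inverse_id]
  pentagon := by intros; ext X; simp [inverse_comp, inverse_id]
  triangle := by intros; ext X; simp [inverse_comp, inverse_id]


section

variable {E F G H : GrothendieckTopos.{u}}

@[simp] lemma onInverse_whiskerLeft (f : E ⟶ F) {g h : F ⟶ G} (η : g ⟶ h) :
    (f ◁ η).onInverse = Functor.whiskerRight η.onInverse f.inverse := rfl

@[simp] lemma onInverse_whiskerRight {f g : E ⟶ F} (η : f ⟶ g) (h : F ⟶ G) :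
    (η ▷ h).onInverse = Functor.whiskerLeft h.inverse η.onInverse := rfl

@[simp] lemma onInverse_associator_hom (f : E ⟶ F) (g : F ⟶ G) (h : G ⟶ H) :
    (α_ f g h).hom.onInverse = (Functor.associator h.inverse g.inverse f.inverse).inv := rfl

@[simp] lemma onInverse_associator_inv (f : E ⟶ F) (g : F ⟶ G) (h : G ⟶ H) :
    (α_ f g h).inv.onInverse = (Functor.associator h.inverse g.inverse f.inverse).hom := rfl

@[simp] lemma onInverse_leftUnitor_hom (f : E ⟶ F) :
    (λ_ f).hom.onInverse = (Functor.rightUnitor f.inverse).hom := rfl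

@[simp] lemma onInverse_rightUnitor_hom (f : E ⟶ F) :
    (ρ_ f).hom.onInverse = (Functor.leftUnitor f.inverse).hom := rfl

/-- The transformation `g_* ⟶ f_*` between direct images corresponding to a geometric
transformation `f ⟶ g`. -/
def onDirect {f g : E ⟶ F} (η : f ⟶ g) : g.direct ⟶ f.direct :=
  conjugateEquiv g.adj f.adj η.onInverse

lemma onDirect_ext {f g : E ⟶ F} {η θ : f ⟶ g} (h : onDirect η = onDirect θ) : η = θ :=
  geom_hom_ext ((conjugateEquiv g.adj f.adj).injective h)

@[simp] lemma onDirect_id (f : E ⟶ F) : onDirect (𝟙 f) = 𝟙 _ := conjugateEquiv_id _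

@[simp] lemma onDirect_comp {f g h : E ⟶ F} (η : f ⟶ g) (θ : g ⟶ h) :
    onDirect (η ≫ θ) = onDirect θ ≫ onDirect η :=
  (CategoryTheory.conjugateEquiv_comp _ _ _ _ _).symm

@[simp] lemma onDirect_whiskerLeft (f : E ⟶ F) {g h : F ⟶ G} (η : g ⟶ h) :
    onDirect (f ◁ η) = Functor.whiskerLeft f.direct (onDirect η) :=
  conjugateEquiv_whiskerRight _ _ _ _

@[simp] lemma onDirect_whiskerRight {f g : E ⟶ F} (η : f ⟶ g) (h : F ⟶ G) :
    onDirect (η ▷ h) = Functor.whiskerRight (onDirect η) h.direct :=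
  conjugateEquiv_whiskerLeft _ _ _ _

@[simp] lemma onDirect_associator_inv (f : E ⟶ F) (g : F ⟶ G) (h : G ⟶ H) :
    onDirect (α_ f g h).inv = (Functor.associator f.direct g.direct h.direct).hom :=
  conjugateEquiv_associator_hom h.adj g.adj f.adj

@[simp] lemma onDirect_associator_hom (f : E ⟶ F) (g : F ⟶ G) (h : G ⟶ H) :
    onDirect (α_ f g h).hom = (Functor.associator f.direct g.direct h.direct).inv := by
  rw [← cancel_mono (Functor.associator f.direct g.direct h.direct).hom,
    ← onDirect_associator_inv, ← onDirect_comp, onDirect_associator_inv]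
  simp

@[simp] lemma onDirect_leftUnitor_hom (f : E ⟶ F) :
    onDirect (λ_ f).hom = (Functor.leftUnitor f.direct).inv :=
  conjugateEquiv_rightUnitor_hom f.adj

@[simp] lemma onDirect_rightUnitor_hom (f : E ⟶ F) :
    onDirect (ρ_ f).hom = (Functor.rightUnitor f.direct).inv :=
  conjugateEquiv_leftUnitor_hom f.adj

/-- The invertible geometric transformation corresponding to an isomorphism between direct
images. -/
def geomIsoOfDirect {f g : E ⟶ F} (e : g.direct ≅ f.direct) : f ≅ g :=
  geomIso ((conjugateIsoEquiv g.adj f.adj).symm e)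

@[simp] lemma onDirect_geomIsoOfDirect_hom {f g : E ⟶ F} (e : g.direct ≅ f.direct) :
    onDirect (geomIsoOfDirect e).hom = e.hom :=
  (conjugateEquiv g.adj f.adj).apply_symm_apply e.hom

@[simp] lemma onDirect_geomIsoOfDirect_inv {f g : E ⟶ F} (e : g.direct ≅ f.direct) :
    onDirect (geomIsoOfDirect e).inv = e.inv :=
  (conjugateEquiv f.adj g.adj).apply_symm_apply e.inv

@[simp] lemma onDirect_geomMk_symm {f g : E ⟶ F} (α : g.direct ⟶ f.direct) :
    onDirect (geomMk (f := f) (g := g) ((conjugateEquiv g.adj f.adj).symm α)) = α :=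
  (conjugateEquiv g.adj f.adj).apply_symm_apply α

lemma direct_comp (f : E ⟶ F) (g : F ⟶ G) : (f ≫ g).direct = f.direct ⋙ g.direct := rfl

lemma direct_id (E : GrothendieckTopos.{u}) : (𝟙 E : E ⟶ E).direct = 𝟭 _ := rfl

end

end Toposes

section Co

universe w v

/-- The 2-cell dual `B^co` of a bicategory `B`: the same objects and 1-cells, with the direction of
2-cells reversed. -/
structure Co (B : Type u) : Type u where
  unco : B

/-- The 1-cells of `B^co`. -/
structure Co.Hom {B : Type u} [Bicategory.{w, v} B] (X Y : Co B) : Type v where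
  unco : X.unco ⟶ Y.unco

/-- The 2-cells `f ⟶ g` of `B^co` are the 2-cells `g ⟶ f` of `B`. -/
@[ext]
structure Co.Hom₂ {B : Type u} [Bicategory.{w, v} B] {X Y : Co B} (f g : Co.Hom X Y) : Type w where
  unco : g.unco ⟶ f.unco

variable {B : Type u} [Bicategory.{w, v} B]

instance : CategoryStruct (Co B) where
  Hom X Y := Co.Hom X Y
  id X := ⟨𝟙 X.unco⟩
  comp f g := ⟨f.unco ≫ g.unco⟩

instance (X Y : Co B) : Category (X ⟶ Y) where
  Hom f g := Co.Hom₂ f g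
  id f := ⟨𝟙 f.unco⟩
  comp η θ := ⟨θ.unco ≫ η.unco⟩
  id_comp _ := Co.Hom₂.ext (Category.comp_id _)
  comp_id _ := Co.Hom₂.ext (Category.id_comp _)
  assoc _ _ _ := Co.Hom₂.ext (Category.assoc _ _ _).symm

@[ext]
lemma co_hom_ext {X Y : Co B} {f g : X ⟶ Y} {η θ : f ⟶ g} (h : η.unco = θ.unco) : η = θ :=
  Co.Hom₂.ext h

/-- A 2-cell of `B` as a 2-cell of `B^co`. -/
def coMk {X Y : Co B} {f g : X ⟶ Y} (η : g.unco ⟶ f.unco) : f ⟶ g := ⟨η⟩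

/-- An invertible 2-cell of `B` as an invertible 2-cell of `B^co`. -/
def coIso {X Y : Co B} {f g : X ⟶ Y} (e : f.unco ≅ g.unco) : f ≅ g where
  hom := ⟨e.inv⟩
  inv := ⟨e.hom⟩
  hom_inv_id := co_hom_ext e.hom_inv_id
  inv_hom_id := co_hom_ext e.inv_hom_id

@[simp] lemma co_unco_comp₁ {X Y Z : Co B} (f : X ⟶ Y) (g : Y ⟶ Z) :
    (f ≫ g).unco = f.unco ≫ g.unco := rfl
@[simp] lemma co_unco_id₁ (X : Co B) : (𝟙 X : X ⟶ X).unco = 𝟙 X.unco := rfl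
@[simp] lemma co_unco_comp {X Y : Co B} {f g h : X ⟶ Y} (η : f ⟶ g) (θ : g ⟶ h) :
    (η ≫ θ).unco = θ.unco ≫ η.unco := rfl
@[simp] lemma co_unco_id {X Y : Co B} (f : X ⟶ Y) : (𝟙 f : f ⟶ f).unco = 𝟙 f.unco := rfl
@[simp] lemma co_unco_coMk {X Y : Co B} {f g : X ⟶ Y} (η : g.unco ⟶ f.unco) :
    (coMk η : f ⟶ g).unco = η := rfl
@[simp] lemma co_unco_coIso_hom {X Y : Co B} {f g : X ⟶ Y} (e : f.unco ≅ g.unco) :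
    (coIso e : f ≅ g).hom.unco = e.inv := rfl
@[simp] lemma co_unco_coIso_inv {X Y : Co B} {f g : X ⟶ Y} (e : f.unco ≅ g.unco) :
    (coIso e : f ≅ g).inv.unco = e.hom := rfl

instance : Bicategory (Co B) where
  homCategory := inferInstance
  whiskerLeft f _ _ η := coMk (f.unco ◁ η.unco)
  whiskerRight η h := coMk (η.unco ▷ h.unco)
  associator f g h := coIso (f := (f ≫ g) ≫ h) (g := f ≫ g ≫ h) (α_ f.unco g.unco h.unco)
  leftUnitor f := coIso (f := 𝟙 _ ≫ f) (λ_ f.unco)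
  rightUnitor f := coIso (f := f ≫ 𝟙 _) (ρ_ f.unco)
  whisker_exchange η θ := co_hom_ext (whisker_exchange η.unco θ.unco).symm

@[simp] lemma co_unco_whiskerLeft {X Y Z : Co B} (f : X ⟶ Y) {g h : Y ⟶ Z} (η : g ⟶ h) :
    (f ◁ η).unco = f.unco ◁ η.unco := rfl
@[simp] lemma co_unco_whiskerRight {X Y Z : Co B} {f g : X ⟶ Y} (η : f ⟶ g) (h : Y ⟶ Z) :
    (η ▷ h).unco = η.unco ▷ h.unco := rfl
@[simp] lemma co_unco_associator_hom {X Y Z W : Co B} (f : X ⟶ Y) (g : Y ⟶ Z) (h : Z ⟶ W) :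
    (α_ f g h).hom.unco = (α_ f.unco g.unco h.unco).inv := rfl
@[simp] lemma co_unco_leftUnitor_hom {X Y : Co B} (f : X ⟶ Y) :
    (λ_ f).hom.unco = (λ_ f.unco).inv := rfl
@[simp] lemma co_unco_rightUnitor_hom {X Y : Co B} (f : X ⟶ Y) :
    (ρ_ f).hom.unco = (ρ_ f.unco).inv := rfl

end Co

/-- A small site. -/
structure SmallSite : Type (u + 1) where
  C : Type u
  [category : SmallCategory C]
  J : GrothendieckTopology C

attribute [instance] SmallSite.category


section SiteBicategories

open Limits in
/-- A functor `F : C ⥤ D` is covering-flat for a topology `K` on `D` if for every finite diagram `A`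
in `C` and every cone over `A ⋙ F` with vertex `d`, the arrows `v : d' ⟶ d` such that the
restriction of the cone along `v` factors through the image under `F` of some cone over `A` form a
`K`-covering sieve. -/
def IsCoveringFlat {C D : Type u} [SmallCategory C] [SmallCategory D] (K : GrothendieckTopology D)
    (F : C ⥤ D) : Prop :=
  ∀ (I : Type) [SmallCategory I] [FinCategory I] (A : I ⥤ C) (t : Cone (A ⋙ F)),
    ∃ S ∈ K t.pt, ∀ ⦃d : D⦄ (v : d ⟶ t.pt), S v →
      ∃ (a : Cone A) (w : d ⟶ F.obj a.pt), ∀ i : I, w ≫ F.map (a.π.app i) = v ≫ t.π.app i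

/-- Morphisms of sites `(C, J) ⟶ (D, K)`: cover-preserving and covering-flat functors `C ⥤ D`. -/
structure IsMorphismOfSites {C D : Type u} [SmallCategory C] [SmallCategory D]
    (J : GrothendieckTopology C) (K : GrothendieckTopology D) (F : C ⥤ D) : Prop where
  coverPreserving : CoverPreserving J K F
  coveringFlat : IsCoveringFlat K F

/-- Comorphisms of sites `(C, J) ⟶ (D, K)`: cover-lifting functors `C ⥤ D`, i.e. for every `c` and
every `K`-covering sieve `R` on `F c`, the sieve of the arrows sent by `F` into `R` is
`J`-covering. -/
def IsComorphismOfSites {C D : Type u} [SmallCategory C] [SmallCategory D]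
    (J : GrothendieckTopology C) (K : GrothendieckTopology D) (F : C ⥤ D) : Prop :=
  F.IsCocontinuous J K

/-- A class of functors between small sites which contains identities and is closed under
composition. -/
structure SiteFunctorClass where
  mem (X Y : SmallSite.{u}) : (X.C ⥤ Y.C) → Prop
  id_mem (X : SmallSite.{u}) : mem X X (𝟭 X.C)
  comp_mem {X Y Z : SmallSite.{u}} {F : X.C ⥤ Y.C} {G : Y.C ⥤ Z.C} (hF : mem X Y F)
    (hG : mem Y Z G) : mem X Z (F ⋙ G)

/-- The objects of the 2-category of small sites, functors in the class `P` and natural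
transformations. -/
structure SitesWith (P : SiteFunctorClass.{u}) : Type (u + 1) where
  site : SmallSite.{u}

/-- Functors in the class `P`. -/
structure SitesWith.Hom {P : SiteFunctorClass.{u}} (X Y : SitesWith P) : Type u where
  functor : X.site.C ⥤ Y.site.C
  mem : P.mem X.site Y.site functor

/-- Natural transformations between functors in the class `P`. -/
@[ext]
structure SitesWith.Hom₂ {P : SiteFunctorClass.{u}} {X Y : SitesWith P} (f g : SitesWith.Hom X Y) :
    Type u where
  nat : f.functor ⟶ g.functor

section

variable {P : SiteFunctorClass.{u}}

instance : CategoryStruct (SitesWith P) where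
  Hom X Y := SitesWith.Hom X Y
  id X := ⟨𝟭 _, P.id_mem _⟩
  comp f g := ⟨f.functor ⋙ g.functor, P.comp_mem f.mem g.mem⟩

instance (X Y : SitesWith P) : Category (X ⟶ Y) where
  Hom f g := SitesWith.Hom₂ f g
  id f := ⟨𝟙 f.functor⟩
  comp η θ := ⟨η.nat ≫ θ.nat⟩

@[ext]
lemma sites_hom_ext {X Y : SitesWith P} {f g : X ⟶ Y} {η θ : f ⟶ g} (h : η.nat = θ.nat) : η = θ :=
  SitesWith.Hom₂.ext h

/-- A natural transformation as a 2-cell. -/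
def sitesMk {X Y : SitesWith P} {f g : X ⟶ Y} (η : f.functor ⟶ g.functor) : f ⟶ g := ⟨η⟩

/-- A natural isomorphism as an invertible 2-cell. -/
def sitesIso {X Y : SitesWith P} {f g : X ⟶ Y} (e : f.functor ≅ g.functor) : f ≅ g where
  hom := ⟨e.hom⟩
  inv := ⟨e.inv⟩
  hom_inv_id := sites_hom_ext e.hom_inv_id
  inv_hom_id := sites_hom_ext e.inv_hom_id

@[simp] lemma sites_functor_comp {X Y Z : SitesWith P} (f : X ⟶ Y) (g : Y ⟶ Z) :
    (f ≫ g).functor = f.functor ⋙ g.functor := rfl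
@[simp] lemma sites_functor_id (X : SitesWith P) : (𝟙 X : X ⟶ X).functor = 𝟭 _ := rfl
@[simp] lemma sites_nat_comp {X Y : SitesWith P} {f g h : X ⟶ Y} (η : f ⟶ g) (θ : g ⟶ h) :
    (η ≫ θ).nat = η.nat ≫ θ.nat := rfl
@[simp] lemma sites_nat_id {X Y : SitesWith P} (f : X ⟶ Y) : (𝟙 f : f ⟶ f).nat = 𝟙 _ := rfl
@[simp] lemma sites_nat_sitesMk {X Y : SitesWith P} {f g : X ⟶ Y} (η : f.functor ⟶ g.functor) :
    (sitesMk η : f ⟶ g).nat = η := rfl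
@[simp] lemma sites_nat_sitesIso_hom {X Y : SitesWith P} {f g : X ⟶ Y}
    (e : f.functor ≅ g.functor) : (sitesIso e : f ≅ g).hom.nat = e.hom := rfl
@[simp] lemma sites_nat_sitesIso_inv {X Y : SitesWith P} {f g : X ⟶ Y}
    (e : f.functor ≅ g.functor) : (sitesIso e : f ≅ g).inv.nat = e.inv := rfl

instance : Bicategory (SitesWith P) where
  homCategory := inferInstance
  whiskerLeft f _ _ η := sitesMk (Functor.whiskerLeft f.functor η.nat)
  whiskerRight η h := sitesMk (Functor.whiskerRight η.nat h.functor)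
  associator f g h := sitesIso (f := (f ≫ g) ≫ h) (g := f ≫ g ≫ h)
    (Functor.associator f.functor g.functor h.functor)
  leftUnitor f := sitesIso (f := 𝟙 _ ≫ f) (Functor.leftUnitor f.functor)
  rightUnitor f := sitesIso (f := f ≫ 𝟙 _) (Functor.rightUnitor f.functor)

@[simp] lemma sites_nat_whiskerLeft {X Y Z : SitesWith P} (f : X ⟶ Y) {g h : Y ⟶ Z} (η : g ⟶ h) :
    (f ◁ η).nat = Functor.whiskerLeft f.functor η.nat := rfl
@[simp] lemma sites_nat_whiskerRight {X Y Z : SitesWith P} {f g : X ⟶ Y} (η : f ⟶ g) (h : Y ⟶ Z) :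
    (η ▷ h).nat = Functor.whiskerRight η.nat h.functor := rfl
@[simp] lemma sites_nat_associator_hom {X Y Z W : SitesWith P} (f : X ⟶ Y) (g : Y ⟶ Z)
    (h : Z ⟶ W) :
    (α_ f g h).hom.nat = (Functor.associator f.functor g.functor h.functor).hom := rfl
@[simp] lemma sites_nat_associator_inv {X Y Z W : SitesWith P} (f : X ⟶ Y) (g : Y ⟶ Z)
    (h : Z ⟶ W) :
    (α_ f g h).inv.nat = (Functor.associator f.functor g.functor h.functor).inv := rfl
@[simp] lemma sites_nat_leftUnitor_hom {X Y : SitesWith P} (f : X ⟶ Y) :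
    (λ_ f).hom.nat = (Functor.leftUnitor f.functor).hom := rfl
@[simp] lemma sites_nat_leftUnitor_inv {X Y : SitesWith P} (f : X ⟶ Y) :
    (λ_ f).inv.nat = (Functor.leftUnitor f.functor).inv := rfl
@[simp] lemma sites_nat_rightUnitor_hom {X Y : SitesWith P} (f : X ⟶ Y) :
    (ρ_ f).hom.nat = (Functor.rightUnitor f.functor).hom := rfl
@[simp] lemma sites_nat_rightUnitor_inv {X Y : SitesWith P} (f : X ⟶ Y) :
    (ρ_ f).inv.nat = (Functor.rightUnitor f.functor).inv := rfl

end

lemma isMorphismOfSites_id {C : Type u} [SmallCategory C] (J : GrothendieckTopology C) :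
    IsMorphismOfSites J J (𝟭 C) where
  coverPreserving := idCoverPreserving J
  coveringFlat I _ _ A t := by
    refine ⟨⊤, J.top_mem _, fun d v _ => ⟨⟨t.pt, ⟨fun i => t.π.app i, ?_⟩⟩, v, fun i => rfl⟩⟩
    intro i j m
    exact t.π.naturality m

lemma IsMorphismOfSites.comp {C D E : Type u} [SmallCategory C] [SmallCategory D] [SmallCategory E]
    {J : GrothendieckTopology C} {K : GrothendieckTopology D} {L : GrothendieckTopology E}
    {F : C ⥤ D} {G : D ⥤ E} (hF : IsMorphismOfSites J K F) (hG : IsMorphismOfSites K L G) :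
    IsMorphismOfSites J L (F ⋙ G) where
  coverPreserving := CoverPreserving.comp J K hF.coverPreserving hG.coverPreserving
  coveringFlat I _ _ A t := by
    obtain ⟨S, hS, h⟩ := hG.coveringFlat I (A ⋙ F) ⟨t.pt, t.π⟩
    let R : Sieve t.pt :=
      { arrows := fun d v => ∃ (a : Limits.Cone A) (w : d ⟶ G.obj (F.obj a.pt)),
          ∀ i : I, w ≫ G.map (F.map (a.π.app i)) = v ≫ t.π.app i
        downward_closed := by
          rintro _ _ v ⟨a, w, hw⟩ x
          exact ⟨a, x ≫ w, fun i => by simp [hw]⟩ }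
    refine ⟨R, mem_of_local hS ?_, fun d v hv => hv⟩
    intro e v hv
    obtain ⟨a, w, hw⟩ := h v hv
    obtain ⟨T, hT, h'⟩ := hF.coveringFlat I A a
    refine ⟨_, L.pullback_stable w (hG.coverPreserving.cover_preserve hT), ?_⟩
    rintro e' x ⟨d, y, z, hy, e₁⟩
    obtain ⟨b, k, hk⟩ := h' y hy
    refine ⟨b, z ≫ G.map k, fun i => ?_⟩
    rw [Category.assoc, ← G.map_comp, hk, G.map_comp, ← Category.assoc, ← e₁, Category.assoc, hw i,
      Category.assoc]

/-- The class of morphisms of sites. -/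
def morphismsOfSites : SiteFunctorClass.{u} where
  mem X Y F := IsMorphismOfSites X.J Y.J F
  id_mem X := isMorphismOfSites_id X.J
  comp_mem hF hG := hF.comp hG

/-- The class of comorphisms of sites. -/
def comorphismsOfSites : SiteFunctorClass.{u} where
  mem X Y F := IsComorphismOfSites X.J Y.J F
  id_mem X := isCocontinuous_id X.J
  comp_mem {X Y Z F G} hF hG :=
    have : F.IsCocontinuous X.J Y.J := hF
    have : G.IsCocontinuous Y.J Z.J := hG
    isCocontinuous_comp F G X.J Y.J

/-- The 2-category `Site^♭` of small sites, morphisms of sites and natural transformations. -/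
abbrev SiteFlat : Type (u + 1) := SitesWith morphismsOfSites.{u}

/-- The 2-category `Site^♯` of small sites, comorphisms of sites and natural transformations. -/
abbrev SiteSharp : Type (u + 1) := SitesWith comorphismsOfSites.{u}

/-- The objects of the bicategory of small sites, distributors of sites and transformations. -/
structure SiteDist : Type (u + 1) where
  site : SmallSite.{u}

/-- Distributors of sites. -/
structure SiteDist.Hom (X Y : SiteDist.{u}) : Type (u + 1) where
  dist : Profunctor.{u} X.site.C Y.site.C
  isDistributorOfSites : IsDistributorOfSites X.site.J Y.site.J dist

/-- Transformations of distributors. -/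
@[ext]
structure SiteDist.Hom₂ {X Y : SiteDist.{u}} (H H' : SiteDist.Hom X Y) : Type u where
  nat : H.dist ⟶ H'.dist

instance : CategoryStruct SiteDist.{u} where
  Hom X Y := SiteDist.Hom X Y
  id X := ⟨Profunctor.id, isDistributorOfSites_id X.site.J⟩
  comp H G := ⟨tensor G.dist H.dist, G.isDistributorOfSites.tensor H.isDistributorOfSites⟩

instance (X Y : SiteDist.{u}) : Category (X ⟶ Y) where
  Hom f g := SiteDist.Hom₂ f g
  id f := ⟨𝟙 f.dist⟩
  comp η θ := ⟨η.nat ≫ θ.nat⟩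

@[ext]
lemma siteDist_hom_ext {X Y : SiteDist.{u}} {f g : X ⟶ Y} {η θ : f ⟶ g} (h : η.nat = θ.nat) :
    η = θ := SiteDist.Hom₂.ext h

/-- A transformation of distributors as a 2-cell. -/
def distMk {X Y : SiteDist.{u}} {f g : X ⟶ Y} (η : f.dist ⟶ g.dist) : f ⟶ g := ⟨η⟩

/-- An invertible transformation of distributors as an invertible 2-cell. -/
def distIso {X Y : SiteDist.{u}} {f g : X ⟶ Y} (e : f.dist ≅ g.dist) : f ≅ g where
  hom := ⟨e.hom⟩
  inv := ⟨e.inv⟩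
  hom_inv_id := siteDist_hom_ext e.hom_inv_id
  inv_hom_id := siteDist_hom_ext e.inv_hom_id

section

variable {X Y Z W : SiteDist.{u}}

lemma dist_comp (f : X ⟶ Y) (g : Y ⟶ Z) : (f ≫ g).dist = f.dist ⋙ lext g.dist := rfl
lemma dist_id (X : SiteDist.{u}) : (𝟙 X : X ⟶ X).dist = Profunctor.id := rfl
@[simp] lemma dist_nat_comp {f g h : X ⟶ Y} (η : f ⟶ g) (θ : g ⟶ h) :
    (η ≫ θ).nat = η.nat ≫ θ.nat := rfl
@[simp] lemma dist_nat_id (f : X ⟶ Y) : (𝟙 f : f ⟶ f).nat = 𝟙 f.dist := rfl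
@[simp] lemma dist_nat_distMk {f g : X ⟶ Y} (η : f.dist ⟶ g.dist) :
    (distMk η : f ⟶ g).nat = η := rfl
@[simp] lemma dist_nat_distIso_hom {f g : X ⟶ Y} (e : f.dist ≅ g.dist) :
    (distIso e : f ≅ g).hom.nat = e.hom := rfl
@[simp] lemma dist_nat_distIso_inv {f g : X ⟶ Y} (e : f.dist ≅ g.dist) :
    (distIso e : f ≅ g).inv.nat = e.inv := rfl

/-- The associativity law `F ⊗ (G ⊗ H) ≅ (F ⊗ G) ⊗ H`. -/
def tensorAssoc {A B C D : Type u} [SmallCategory A] [SmallCategory B] [SmallCategory C]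
    [SmallCategory D] (H : Profunctor.{u} A B) (G : Profunctor.{u} B C) (F : Profunctor.{u} C D) :
    tensor F (tensor G H) ≅ tensor (tensor F G) H :=
  Functor.isoWhiskerLeft H (lextTensor F G)

/-- The right unit law `hom ⊗ H ≅ H`. -/
def unitTensor {C D : Type u} [SmallCategory C] [SmallCategory D] (H : Profunctor.{u} C D) :
    tensor Profunctor.id H ≅ H :=
  Functor.isoWhiskerLeft H (lextUnit D)

end

/-- The bicategory of small sites, distributors of sites and transformations. -/
instance : Bicategory SiteDist.{u} where
  homCategory := inferInstance
  whiskerLeft f _ _ η := distMk (Functor.whiskerLeft f.dist (lextMap η.nat))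
  whiskerRight η h := distMk (Functor.whiskerRight η.nat (lext h.dist))
  associator f g h := distIso (f := (f ≫ g) ≫ h) (g := f ≫ g ≫ h)
    (tensorAssoc f.dist g.dist h.dist)
  leftUnitor f := distIso (f := 𝟙 _ ≫ f) (tensorUnit f.dist)
  rightUnitor f := distIso (f := f ≫ 𝟙 _) (unitTensor f.dist)
  whiskerLeft_id := by
    intros; ext c d z; induction z using LextObj.ind with
    | h c x s => rfl
  whiskerLeft_comp := by
    intros; ext c d z; induction z using LextObj.ind with
    | h c x s => rfl
  id_whiskerLeft := by
    intro X Y f g η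
    rw [← Category.assoc, Iso.eq_comp_inv]
    ext c d z; induction z using LextObj.ind with
    | h c' x s =>
      exact (ConcreteCategory.congr_hom (NatTrans.congr_app (η.nat.naturality s) d) x).symm
  comp_whiskerLeft := by
    intros; ext c d z; induction z using LextObj.ind with
    | h c x s => induction s using LextObj.ind with
      | h c y s => rfl
  id_whiskerRight := by
    intros; ext c d z; induction z using LextObj.ind with
    | h c x s => rfl
  comp_whiskerRight := by
    intros; ext c d z; induction z using LextObj.ind with
    | h c x s => rfl
  whiskerRight_id := by
    intro X Y f g η
    rw [← Category.assoc, Iso.eq_comp_inv]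
    ext c d z; induction z using LextObj.ind with
    | h c' x s =>
      exact (NatTrans.naturality_apply (η.nat.app c) (Quiver.Hom.op x) s).symm
  whiskerRight_comp := by
    intro X Y Z W f f' η g h; ext c d z; induction z using LextObj.ind with
    | h c x s => induction x using LextObj.ind (H := h.dist) with
      | h c y x => rfl
  whisker_assoc := by
    intros; ext c d z; induction z using LextObj.ind with
    | h c x s => induction s using LextObj.ind with
      | h c y s => rfl
  whisker_exchange := by
    intros; ext c d z; induction z using LextObj.ind with
    | h c x s => rfl
  pentagon := by
    intros; ext c d z; induction z using LextObj.ind with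
    | h c x s => induction s using LextObj.ind with
      | h c y s => induction s using LextObj.ind with
        | h c w s => rfl
  triangle := by
    intro X Y Z f g; ext c d z; induction z using LextObj.ind with
    | h c x s => induction s using LextObj.ind with
      | h c' y s => exact (LextObj.sound y x s).symm

end SiteBicategories

section SheafGeometric

variable {C D : Type u} [SmallCategory C] [SmallCategory D] {J : GrothendieckTopology C}
  {K : GrothendieckTopology D}

/-- The restriction to sheaves of a functor on presheaves which preserves sheaves. -/
def sheafRight (R : (Dᵒᵖ ⥤ Type u) ⥤ (Cᵒᵖ ⥤ Type u))
    (hR : ∀ Y : Sheaf K (Type u), Presheaf.IsSheaf J (R.obj Y.obj)) :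
    Sheaf K (Type u) ⥤ Sheaf J (Type u) where
  obj Y := ⟨R.obj Y.obj, hR Y⟩
  map f := ⟨R.map f.hom⟩

/-- If `L ⊣ R` on presheaves and `R` preserves sheaves, then `a_K ∘ L ∘ i_J` is left adjoint to the
restriction of `R` to sheaves. -/
def sheafAdj {L : (Cᵒᵖ ⥤ Type u) ⥤ (Dᵒᵖ ⥤ Type u)} {R : (Dᵒᵖ ⥤ Type u) ⥤ (Cᵒᵖ ⥤ Type u)}
    (adj : L ⊣ R) (hR : ∀ Y : Sheaf K (Type u), Presheaf.IsSheaf J (R.obj Y.obj)) :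
    sheafToPresheaf J (Type u) ⋙ L ⋙ presheafToSheaf K (Type u) ⊣ sheafRight R hR :=
  Adjunction.mkOfHomEquiv
    { homEquiv := fun X Y =>
        { toFun := fun f => ⟨adj.homEquiv X.obj Y.obj
            ((sheafificationAdjunction K (Type u)).homEquiv (L.obj X.obj) Y f)⟩
          invFun := fun g => ((sheafificationAdjunction K (Type u)).homEquiv (L.obj X.obj) Y).symm
            ((adj.homEquiv X.obj Y.obj).symm g.hom)
          left_inv := fun f => by simp
          right_inv := fun g => by
            apply Sheaf.hom_ext
            exact (congrArg _ (Equiv.apply_symm_apply _ _)).trans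
              (Equiv.apply_symm_apply (adj.homEquiv X.obj Y.obj) g.hom) }
      homEquiv_naturality_left_symm := fun {X' X Y} f g => by
        exact (congrArg _ (Adjunction.homEquiv_naturality_left_symm adj f.hom g.hom)).trans
          (Adjunction.homEquiv_naturality_left_symm (sheafificationAdjunction K (Type u)) _ _)
      homEquiv_naturality_right := fun {X Y Y'} f g => by
        apply Sheaf.hom_ext
        exact (congrArg _ (Adjunction.homEquiv_naturality_right
          (sheafificationAdjunction K (Type u)) f g)).trans
            (Adjunction.homEquiv_naturality_right adj _ _) }

lemma sheafAdj_homEquiv_hom {L : (Cᵒᵖ ⥤ Type u) ⥤ (Dᵒᵖ ⥤ Type u)}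
    {R : (Dᵒᵖ ⥤ Type u) ⥤ (Cᵒᵖ ⥤ Type u)} (adj : L ⊣ R)
    (hR : ∀ Y : Sheaf K (Type u), Presheaf.IsSheaf J (R.obj Y.obj)) (X : Sheaf J (Type u))
    (Y : Sheaf K (Type u)) (f : (presheafToSheaf K (Type u)).obj (L.obj X.obj) ⟶ Y) :
    ((sheafAdj adj hR).homEquiv X Y f).hom =
      adj.homEquiv X.obj Y.obj
        ((sheafificationAdjunction K (Type u)).homEquiv (L.obj X.obj) Y f) := by
  rw [sheafAdj, Adjunction.mkOfHomEquiv_homEquiv]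
  rfl

lemma conjugateEquiv_eq_of {A B : Type*} [Category* A] [Category* B] {L₁ L₂ : A ⥤ B}
    {R₁ R₂ : B ⥤ A} (adj₁ : L₁ ⊣ R₁) (adj₂ : L₂ ⊣ R₂) (α : L₂ ⟶ L₁) (β : R₁ ⟶ R₂)
    (h : ∀ (X : A) (Y : B) (f : L₁.obj X ⟶ Y), adj₂.homEquiv X Y (α.app X ≫ f) =
      adj₁.homEquiv X Y f ≫ β.app Y) : CategoryTheory.conjugateEquiv adj₁ adj₂ α = β := by
  ext Y
  have := h (R₁.obj Y) Y (adj₁.counit.app Y)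
  rw [CategoryTheory.conjugateEquiv_apply_app]
  simpa [Adjunction.homEquiv_unit] using this

lemma homEquiv_comp_conjugateEquiv {A B : Type*} [Category* A] [Category* B] {L L' : A ⥤ B}
    {R R' : B ⥤ A} (adj : L ⊣ R) (adj' : L' ⊣ R') (α : L ⟶ L') {X : A} {Y : B}
    (g : L'.obj X ⟶ Y) : adj.homEquiv X Y (α.app X ≫ g) =
      adj'.homEquiv X Y g ≫ (CategoryTheory.conjugateEquiv adj' adj α).app Y := by
  rw [Adjunction.homEquiv_unit, Adjunction.homEquiv_unit, Category.assoc,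
    NatTrans.naturality, ← Category.assoc, CategoryTheory.unit_conjugateEquiv]
  simp

/-- The geometric morphism `Sh(D, K) ⟶ Sh(C, J)` with inverse image `a_K ∘ L ∘ i_J` and with direct
image the restriction of `R`. -/
def sheafGeom {L : (Cᵒᵖ ⥤ Type u) ⥤ (Dᵒᵖ ⥤ Type u)} {R : (Dᵒᵖ ⥤ Type u) ⥤ (Cᵒᵖ ⥤ Type u)}
    (adj : L ⊣ R) (hR : ∀ Y : Sheaf K (Type u), Presheaf.IsSheaf J (R.obj Y.obj))
    (hL : Limits.PreservesFiniteLimits (L ⋙ presheafToSheaf K (Type u))) :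
    sheafTopos K ⟶ sheafTopos J where
  inverse := sheafToPresheaf J (Type u) ⋙ L ⋙ presheafToSheaf K (Type u)
  direct := sheafRight R hR
  adj := sheafAdj adj hR
  lex := by
    have : Limits.PreservesFiniteLimits
        (sheafToPresheaf J (Type u) ⋙ L ⋙ presheafToSheaf K (Type u)) :=
      Limits.comp_preservesFiniteLimits _ _
    exact this

/-- A transformation of functors on presheaves, restricted to sheaves. -/
def sheafRightMap {R R' : (Dᵒᵖ ⥤ Type u) ⥤ (Cᵒᵖ ⥤ Type u)} (β : R ⟶ R')
    (hR : ∀ Y : Sheaf K (Type u), Presheaf.IsSheaf J (R.obj Y.obj))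
    (hR' : ∀ Y : Sheaf K (Type u), Presheaf.IsSheaf J (R'.obj Y.obj)) :
    sheafRight R hR ⟶ sheafRight R' hR' where
  app Y := ⟨β.app Y.obj⟩
  naturality _ _ f := by
    apply Sheaf.hom_ext
    exact β.naturality f.hom

/-- The geometric transformation induced by a transformation `L ⟶ L'`. -/
def sheafGeomMap {L L' : (Cᵒᵖ ⥤ Type u) ⥤ (Dᵒᵖ ⥤ Type u)}
    {R R' : (Dᵒᵖ ⥤ Type u) ⥤ (Cᵒᵖ ⥤ Type u)} {adj : L ⊣ R} {adj' : L' ⊣ R'}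
    {hR : ∀ Y : Sheaf K (Type u), Presheaf.IsSheaf J (R.obj Y.obj)}
    {hR' : ∀ Y : Sheaf K (Type u), Presheaf.IsSheaf J (R'.obj Y.obj)}
    {hL : Limits.PreservesFiniteLimits (L ⋙ presheafToSheaf K (Type u))}
    {hL' : Limits.PreservesFiniteLimits (L' ⋙ presheafToSheaf K (Type u))} (α : L ⟶ L') :
    sheafGeom adj hR hL ⟶ sheafGeom adj' hR' hL' :=
  geomMk (Functor.whiskerLeft (sheafToPresheaf J (Type u))
    (Functor.whiskerRight α (presheafToSheaf K (Type u))))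

lemma onDirect_sheafGeomMap {L L' : (Cᵒᵖ ⥤ Type u) ⥤ (Dᵒᵖ ⥤ Type u)}
    {R R' : (Dᵒᵖ ⥤ Type u) ⥤ (Cᵒᵖ ⥤ Type u)} {adj : L ⊣ R} {adj' : L' ⊣ R'}
    {hR : ∀ Y : Sheaf K (Type u), Presheaf.IsSheaf J (R.obj Y.obj)}
    {hR' : ∀ Y : Sheaf K (Type u), Presheaf.IsSheaf J (R'.obj Y.obj)}
    {hL : Limits.PreservesFiniteLimits (L ⋙ presheafToSheaf K (Type u))}
    {hL' : Limits.PreservesFiniteLimits (L' ⋙ presheafToSheaf K (Type u))} (α : L ⟶ L') :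
    onDirect (sheafGeomMap α : sheafGeom adj hR hL ⟶ sheafGeom adj' hR' hL') =
      sheafRightMap (CategoryTheory.conjugateEquiv adj' adj α) hR' hR := by
  refine conjugateEquiv_eq_of (sheafAdj adj' hR') (sheafAdj adj hR) _ _ fun X Y f => ?_
  apply Sheaf.hom_ext
  refine (sheafAdj_homEquiv_hom adj hR X Y _).trans ?_
  refine Eq.trans ?_ (congrArg (· ≫ (CategoryTheory.conjugateEquiv adj' adj α).app Y.obj)
    (sheafAdj_homEquiv_hom adj' hR' X Y f)).symm
  refine (congrArg (adj.homEquiv X.obj Y.obj) (Adjunction.homEquiv_naturality_left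
    (sheafificationAdjunction K (Type u)) (α.app X.obj) f)).trans ?_
  exact homEquiv_comp_conjugateEquiv adj adj' α _

end SheafGeometric

section SheafSystem

universe w v v'

/-- Data on the presheaf level inducing a pseudofunctor from a bicategory to toposes of sheaves: to a
1-cell `f : a ⟶ b` is assigned an adjunction `L f ⊣ R f` between presheaves on sites of `b` and `a`,
inducing a geometric morphism between sheaves; to a 2-cell `f ⟶ g` a transformation `L f ⟶ L g`. -/
structure SheafSystem (B : Type v') [Bicategory.{w, v} B] where
  site : B → SmallSite.{u}
  L {a b : B} (f : a ⟶ b) : ((site b).Cᵒᵖ ⥤ Type u) ⥤ ((site a).Cᵒᵖ ⥤ Type u)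
  R {a b : B} (f : a ⟶ b) : ((site a).Cᵒᵖ ⥤ Type u) ⥤ ((site b).Cᵒᵖ ⥤ Type u)
  adj {a b : B} (f : a ⟶ b) : L f ⊣ R f
  isSheaf {a b : B} (f : a ⟶ b) (Y : Sheaf (site a).J (Type u)) :
    Presheaf.IsSheaf (site b).J ((R f).obj Y.obj)
  lex {a b : B} (f : a ⟶ b) :
    Limits.PreservesFiniteLimits (L f ⋙ presheafToSheaf (site a).J (Type u))
  map₂ {a b : B} {f g : a ⟶ b} (η : f ⟶ g) : L f ⟶ L g
  map₂_id {a b : B} (f : a ⟶ b) : map₂ (𝟙 f) = 𝟙 _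
  map₂_comp {a b : B} {f g h : a ⟶ b} (η : f ⟶ g) (θ : g ⟶ h) : map₂ (η ≫ θ) = map₂ η ≫ map₂ θ
  id (a : B) : 𝟭 _ ≅ R (𝟙 a)
  comp {a b c : B} (f : a ⟶ b) (g : b ⟶ c) : R f ⋙ R g ≅ R (f ≫ g)
  whiskerLeft {a b c : B} (f : a ⟶ b) {g h : b ⟶ c} (η : g ⟶ h) :
    CategoryTheory.conjugateEquiv (adj _) (adj _) (map₂ (f ◁ η)) = (comp f h).inv ≫
      Functor.whiskerLeft (R f) (CategoryTheory.conjugateEquiv (adj _) (adj _) (map₂ η)) ≫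
        (comp f g).hom
  whiskerRight {a b c : B} {f g : a ⟶ b} (η : f ⟶ g) (h : b ⟶ c) :
    CategoryTheory.conjugateEquiv (adj _) (adj _) (map₂ (η ▷ h)) = (comp g h).inv ≫
      Functor.whiskerRight (CategoryTheory.conjugateEquiv (adj _) (adj _) (map₂ η)) (R h) ≫
        (comp f h).hom
  associator {a b c d : B} (f : a ⟶ b) (g : b ⟶ c) (h : c ⟶ d) :
    CategoryTheory.conjugateEquiv (adj _) (adj _) (map₂ (α_ f g h).hom) =
      (comp f (g ≫ h)).inv ≫ Functor.whiskerLeft (R f) (comp g h).inv ≫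
        (Functor.associator _ _ _).inv ≫ Functor.whiskerRight (comp f g).hom (R h) ≫
          (comp (f ≫ g) h).hom
  leftUnitor {a b : B} (f : a ⟶ b) :
    CategoryTheory.conjugateEquiv (adj _) (adj _) (map₂ (λ_ f).hom) =
      (Functor.leftUnitor _).inv ≫ Functor.whiskerRight (id a).hom (R f) ≫ (comp (𝟙 a) f).hom
  rightUnitor {a b : B} (f : a ⟶ b) :
    CategoryTheory.conjugateEquiv (adj _) (adj _) (map₂ (ρ_ f).hom) =
      (Functor.rightUnitor _).inv ≫ Functor.whiskerLeft (R f) (id b).hom ≫ (comp f (𝟙 b)).hom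

variable {B : Type v'} [Bicategory.{w, v} B] (S : SheafSystem.{u, w, v} B)

/-- The geometric morphism assigned to a 1-cell. -/
def SheafSystem.geom {a b : B} (f : a ⟶ b) :
    sheafTopos (S.site a).J ⟶ sheafTopos (S.site b).J :=
  sheafGeom (S.adj f) (S.isSheaf f) (S.lex f)

/-- The geometric transformation assigned to a 2-cell. -/
def SheafSystem.geomMap {a b : B} {f g : a ⟶ b} (η : f ⟶ g) : S.geom f ⟶ S.geom g :=
  sheafGeomMap (S.map₂ η)

lemma SheafSystem.onDirect_geomMap {a b : B} {f g : a ⟶ b} (η : f ⟶ g) :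
    onDirect (S.geomMap η) = sheafRightMap
      (CategoryTheory.conjugateEquiv (S.adj g) (S.adj f) (S.map₂ η)) (S.isSheaf g) (S.isSheaf f) :=
  onDirect_sheafGeomMap _

/-- The direct image part of `SheafSystem.geomId`. -/
def SheafSystem.idDirect (a : B) :
    𝟭 (Sheaf (S.site a).J (Type u)) ≅ sheafRight (S.R (𝟙 a)) (S.isSheaf _) :=
  NatIso.ofComponents (fun Y => (fullyFaithfulSheafToPresheaf _ _).preimageIso
      (Y := (sheafRight (S.R (𝟙 a)) (S.isSheaf _)).obj Y) ((S.id a).app Y.obj))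
    (fun {Y Y'} f => by
      apply Sheaf.hom_ext
      exact (S.id a).hom.naturality f.hom)

/-- The direct image part of `SheafSystem.geomComp`. -/
def SheafSystem.compDirect {a b c : B} (f : a ⟶ b) (g : b ⟶ c) :
    sheafRight (S.R f) (S.isSheaf _) ⋙ sheafRight (S.R g) (S.isSheaf _) ≅
      sheafRight (S.R (f ≫ g)) (S.isSheaf _) :=
  NatIso.ofComponents (fun Y => (fullyFaithfulSheafToPresheaf _ _).preimageIso
      (X := (sheafRight (S.R f) (S.isSheaf _) ⋙ sheafRight (S.R g) (S.isSheaf _)).obj Y)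
      (Y := (sheafRight (S.R (f ≫ g)) (S.isSheaf _)).obj Y) ((S.comp f g).app Y.obj))
    (fun {Y Y'} h => by
      apply Sheaf.hom_ext
      exact (S.comp f g).hom.naturality h.hom)

/-- Compatibility of `S.geom` with identities. -/
def SheafSystem.geomId (a : B) : S.geom (𝟙 a) ≅ 𝟙 (sheafTopos (S.site a).J) :=
  geomIsoOfDirect (S.idDirect a)

/-- Compatibility of `S.geom` with composition. -/
def SheafSystem.geomComp {a b c : B} (f : a ⟶ b) (g : b ⟶ c) :
    S.geom (f ≫ g) ≅ S.geom f ≫ S.geom g :=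
  geomIsoOfDirect (S.compDirect f g)

lemma SheafSystem.onDirect_geomId_hom (a : B) :
    onDirect (S.geomId a).hom = (S.idDirect a).hom := onDirect_geomIsoOfDirect_hom _

lemma SheafSystem.onDirect_geomComp_hom {a b c : B} (f : a ⟶ b) (g : b ⟶ c) :
    onDirect (S.geomComp f g).hom = (S.compDirect f g).hom := onDirect_geomIsoOfDirect_hom _

lemma SheafSystem.onDirect_geomComp_inv {a b c : B} (f : a ⟶ b) (g : b ⟶ c) :
    onDirect (S.geomComp f g).inv = (S.compDirect f g).inv := onDirect_geomIsoOfDirect_inv _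

/-- The pseudofunctor to toposes of sheaves induced by a system of adjunctions on presheaves. -/
def SheafSystem.toPseudofunctor : B ⥤ᵖ GrothendieckTopos.{u} where
  obj a := sheafTopos (S.site a).J
  map f := S.geom f
  map₂ η := S.geomMap η
  map₂_id f := by
    refine geom_hom_ext ?_
    exact (congrArg (fun α => Functor.whiskerLeft (sheafToPresheaf _ (Type u))
      (Functor.whiskerRight α (presheafToSheaf _ (Type u)))) (S.map₂_id f)).trans
        ((congrArg _ (Functor.whiskerRight_id' _)).trans (Functor.whiskerLeft_id' _))
  map₂_comp {a b f g h} η θ := by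
    refine geom_hom_ext ?_
    exact (congrArg (fun α => Functor.whiskerLeft (sheafToPresheaf _ (Type u))
      (Functor.whiskerRight α (presheafToSheaf _ (Type u)))) (S.map₂_comp η θ)).trans
        ((congrArg _ (Functor.whiskerRight_comp _ _ _)).trans (Functor.whiskerLeft_comp _ _ _))
  mapId a := S.geomId a
  mapComp f g := S.geomComp f g
  map₂_whisker_left {a b c} f {g h} η := by
    apply onDirect_ext
    simp only [onDirect_comp, onDirect_whiskerLeft, onDirect_whiskerRight,
      S.onDirect_geomId_hom, S.onDirect_geomComp_hom, S.onDirect_geomComp_inv, S.onDirect_geomMap,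
      onDirect_associator_hom, onDirect_leftUnitor_hom, onDirect_rightUnitor_hom, Category.assoc]
    refine NatTrans.ext (funext fun Y => Sheaf.hom_ext ?_)
    exact congr_app (S.whiskerLeft f η) Y.obj
  map₂_whisker_right {a b c f g} η h := by
    apply onDirect_ext
    simp only [onDirect_comp, onDirect_whiskerLeft, onDirect_whiskerRight,
      S.onDirect_geomId_hom, S.onDirect_geomComp_hom, S.onDirect_geomComp_inv, S.onDirect_geomMap,
      onDirect_associator_hom, onDirect_leftUnitor_hom, onDirect_rightUnitor_hom, Category.assoc]
    refine NatTrans.ext (funext fun Y => Sheaf.hom_ext ?_)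
    exact congr_app (S.whiskerRight η h) Y.obj
  map₂_associator {a b c d} f g h := by
    apply onDirect_ext
    simp only [onDirect_comp, onDirect_whiskerLeft, onDirect_whiskerRight,
      S.onDirect_geomId_hom, S.onDirect_geomComp_hom, S.onDirect_geomComp_inv, S.onDirect_geomMap,
      onDirect_associator_hom, onDirect_leftUnitor_hom, onDirect_rightUnitor_hom, Category.assoc]
    refine NatTrans.ext (funext fun Y => Sheaf.hom_ext ?_)
    exact congr_app (S.associator f g h) Y.obj
  map₂_left_unitor {a b} f := by
    apply onDirect_ext
    simp only [onDirect_comp, onDirect_whiskerLeft, onDirect_whiskerRight,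
      S.onDirect_geomId_hom, S.onDirect_geomComp_hom, S.onDirect_geomComp_inv, S.onDirect_geomMap,
      onDirect_associator_hom, onDirect_leftUnitor_hom, onDirect_rightUnitor_hom, Category.assoc]
    refine NatTrans.ext (funext fun Y => Sheaf.hom_ext ?_)
    exact congr_app (S.leftUnitor f) Y.obj
  map₂_right_unitor {a b} f := by
    apply onDirect_ext
    simp only [onDirect_comp, onDirect_whiskerLeft, onDirect_whiskerRight,
      S.onDirect_geomId_hom, S.onDirect_geomComp_hom, S.onDirect_geomComp_inv, S.onDirect_geomMap,
      onDirect_associator_hom, onDirect_leftUnitor_hom, onDirect_rightUnitor_hom, Category.assoc]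
    refine NatTrans.ext (funext fun Y => Sheaf.hom_ext ?_)
    exact congr_app (S.rightUnitor f) Y.obj

end SheafSystem

section ShSystem

section

variable {B C D : Type u} [SmallCategory B] [SmallCategory C] [SmallCategory D]

/-- Precomposition with a transformation of distributors. -/
def restMap {H H' : Profunctor.{u} C D} (φ : H ⟶ H') : rest H' ⟶ rest H where
  app Y := Functor.whiskerRight (NatTrans.op φ) (yoneda.obj Y)

lemma conjugateEquiv_lextMap {H H' : Profunctor.{u} C D} (φ : H ⟶ H') :
    CategoryTheory.conjugateEquiv (lextAdj H') (lextAdj H) (lextMap φ) = restMap φ := by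
  refine conjugateEquiv_eq_of _ _ _ _ fun X Y f => ?_
  rw [lextAdj, lextAdj, Adjunction.mkOfHomEquiv_homEquiv, Adjunction.mkOfHomEquiv_homEquiv]
  rfl

/-- `rest` for the unit distributor (Yoneda). -/
def restUnit (C : Type u) [SmallCategory C] :
    𝟭 (Cᵒᵖ ⥤ Type u) ≅ rest (Profunctor.id (C := C)) :=
  NatIso.ofComponents (fun Y => NatIso.ofComponents (fun c =>
      { hom := ↾(fun (y : Y.obj c) => yonedaEquiv.symm y)
        inv := ↾(fun (z : yoneda.obj c.unop ⟶ Y) => yonedaEquiv z)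
        hom_inv_id := by
          ext y
          exact yonedaEquiv.apply_symm_apply y
        inv_hom_id := by
          ext z
          exact yonedaEquiv.symm_apply_apply z })
      (fun {c c'} f => by
        ext y
        exact (yonedaEquiv_symm_naturality_left f.unop Y y).symm))
    (fun {Y Y'} g => by
      ext c y
      exact (yonedaEquiv_symm_naturality_right c.unop g y).symm)

/-- `rest_H ∘ rest_G ≅ rest_{G ⊗ H}`. -/
def restTensor (G : Profunctor.{u} C D) (H : Profunctor.{u} B C) :
    rest G ⋙ rest H ≅ rest (tensor G H) :=
  NatIso.ofComponents (fun Y => NatIso.ofComponents (fun b =>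
      { hom := ↾(fun (y : H.obj b.unop ⟶ (rest G).obj Y) =>
          (((lextAdj G).homEquiv (H.obj b.unop) Y).symm y :))
        inv := ↾(fun (z : (lext G).obj (H.obj b.unop) ⟶ Y) =>
          (lextAdj G).homEquiv (H.obj b.unop) Y z)
        hom_inv_id := by
          ext y
          exact Equiv.apply_symm_apply _ _
        inv_hom_id := by
          ext z
          exact Equiv.symm_apply_apply _ _ })
      (fun {b b'} f => by
        ext y
        exact (lextAdj G).homEquiv_naturality_left_symm _ _))
    (fun {Y Y'} g => by
      ext b y
      exact (lextAdj G).homEquiv_naturality_right_symm _ _)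

end

/-- The system of adjunctions `lext_H ⊣ rest_H`. -/
def shSystem : SheafSystem.{u} SiteDist.{u}ᵒᵖ where
  site X := X.unop.site
  L f := lext f.unop.dist
  R f := rest f.unop.dist
  adj f := lextAdj f.unop.dist
  isSheaf f Y := f.unop.isDistributorOfSites.isSheaf_rest Y
  lex f := f.unop.isDistributorOfSites.flat.preservesFiniteLimits
  map₂ η := lextMap η.unop2.nat
  map₂_id f := by
    ext X d z; induction z using LextObj.ind with
    | h c x s => rfl
  map₂_comp η θ := by
    ext X d z; induction z using LextObj.ind with
    | h c x s => rfl
  id X := restUnit X.unop.site.C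
  comp f g := restTensor f.unop.dist g.unop.dist
  whiskerLeft {a b c} f {g h} η := by
    rw [conjugateEquiv_lextMap, conjugateEquiv_lextMap, Iso.eq_inv_comp]
    ext Y b y
    refine NatTrans.ext (funext fun d => ?_)
    ext z; induction z using LextObj.ind with
    | h c x s => rfl
  whiskerRight {a b c f g} η h := by
    rw [conjugateEquiv_lextMap, conjugateEquiv_lextMap, Iso.eq_inv_comp]
    ext Y b y
    refine NatTrans.ext (funext fun d => ?_)
    ext z; induction z using LextObj.ind with
    | h c x s => rfl
  associator {a b c d} f g h := by
    rw [conjugateEquiv_lextMap, Iso.eq_inv_comp, ← Functor.isoWhiskerLeft_inv, Iso.eq_inv_comp]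
    ext Y b y
    refine NatTrans.ext (funext fun d => ?_)
    ext z; induction z using LextObj.ind with
    | h c x s => induction x using LextObj.ind (H := f.unop.dist) with
      | h c' x' s => rfl
  leftUnitor {a b} f := by
    rw [conjugateEquiv_lextMap]
    ext Y b y
    refine NatTrans.ext (funext fun d => ?_)
    ext z; induction z using LextObj.ind with
    | h c x s =>
      exact NatTrans.naturality_apply (show f.unop.dist.obj b.unop ⟶ Y from y) (Quiver.Hom.op x) s
  rightUnitor {a b} f := by
    rw [conjugateEquiv_lextMap]
    ext Y b y
    refine NatTrans.ext (funext fun d => ?_)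
    ext z; induction z using LextObj.ind with
    | h c x s => rfl

end ShSystem

section FlatSystem

open Limits

section

variable {C D : Type u} [SmallCategory C] [SmallCategory D]

/-- The transformation `D(1, F) ⟶ D(1, G)` induced by `F ⟶ G`. -/
def reprMap {F G : C ⥤ D} (φ : F ⟶ G) : F.toProfunctor ⟶ G.toProfunctor where
  app c := yoneda.map (φ.app c)
  naturality _ _ f := (yoneda.map_comp _ _).symm.trans
    ((congrArg yoneda.map (φ.naturality f)).trans (yoneda.map_comp _ _))

/-- The transformation `C(G, 1) ⟶ C(F, 1)` induced by `F ⟶ G`. -/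
def coreprMap {F G : C ⥤ D} (φ : F ⟶ G) : G.toProfunctorRev ⟶ F.toProfunctorRev where
  app d := Functor.whiskerRight (NatTrans.op φ) (yoneda.obj d)
  naturality d d' f := by
    ext c x
    exact (Category.assoc (φ.app c.unop) (show G.obj c.unop ⟶ d from x) f).symm

/-- The representable of a morphism of sites is a distributor of sites. -/
lemma IsMorphismOfSites.isDistributorOfSites {J : GrothendieckTopology C}
    {K : GrothendieckTopology D} {F : C ⥤ D} (hF : IsMorphismOfSites J K F) :
    IsDistributorOfSites J K F.toProfunctor where
  coverDistributing d c x S hS := by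
    refine K.superset_covering (fun d' v hv => ?_)
      (K.pullback_stable (show d ⟶ F.obj c from x) (hF.coverPreserving.cover_preserve hS))
    obtain ⟨c', f, w, hf, e⟩ := hv
    exact ⟨c', f, hf, w, e.symm⟩
  flat :=
    { inhab := fun d => by
        obtain ⟨S, hS, h⟩ := hF.coveringFlat (Discrete PEmpty) (Functor.empty C)
          ⟨d, { app := fun i => i.as.elim, naturality := fun i => i.as.elim }⟩
        refine K.superset_covering (fun d' v hv => ?_) hS
        obtain ⟨a, w, -⟩ := h v hv
        exact ⟨a.pt, ⟨w⟩⟩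
      span := fun {d c c'} x x' => by
        obtain ⟨S, hS, h⟩ := hF.coveringFlat (Discrete WalkingPair) (pair c c')
          ⟨d, { app := fun i => match i with
                  | ⟨WalkingPair.left⟩ => x
                  | ⟨WalkingPair.right⟩ => x'
                naturality := by
                  rintro ⟨i⟩ ⟨j⟩ ⟨⟨e⟩⟩
                  obtain rfl : i = j := e
                  cases i
                  · exact (Category.id_comp _).trans ((congrArg (fun t => (show d ⟶ F.obj c from x) ≫ t)
                      (F.map_id c)).trans (Category.comp_id _)).symm
                  · exact (Category.id_comp _).trans ((congrArg (fun t => (show d ⟶ F.obj c' from x') ≫ t)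
                      (F.map_id c')).trans (Category.comp_id _)).symm }⟩
        refine K.superset_covering (fun d' v hv => ?_) hS
        obtain ⟨a, w, hw⟩ := h v hv
        exact ⟨a.pt, a.π.app ⟨WalkingPair.left⟩, a.π.app ⟨WalkingPair.right⟩, w,
          hw ⟨WalkingPair.left⟩, hw ⟨WalkingPair.right⟩⟩
      eq := fun {d c c'} f f' x e => by
        obtain ⟨S, hS, h⟩ := hF.coveringFlat WalkingParallelPair (parallelPair f f')
          ⟨d, { app := fun i => match i with
                  | WalkingParallelPair.zero => x
                  | WalkingParallelPair.one => (show d ⟶ F.obj c' from x) ≫ F.map f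
                naturality := by
                  rintro _ _ (_ | _ | _)
                  · exact Category.id_comp _
                  · exact (Category.id_comp _).trans e
                  · exact (Category.id_comp _).trans ((congrArg (fun t => _ ≫ t)
                      ((congrArg F.map ((parallelPair f f').map_id _)).trans (F.map_id _))).trans
                        (Category.comp_id _)).symm }⟩
        refine K.superset_covering (fun d' v hv => ?_) hS
        obtain ⟨a, w, hw⟩ := h v hv
        refine ⟨a.pt, a.π.app WalkingParallelPair.zero, w, ?_, hw WalkingParallelPair.zero⟩
        have h₁ := a.w WalkingParallelPairHom.left
        have h₂ := a.w WalkingParallelPairHom.right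
        exact h₁.trans h₂.symm }

/-- `rest_{D(1, F)} ≅ F^*` (Yoneda). -/
def restRepr (F : C ⥤ D) :
    rest F.toProfunctor ≅ (Functor.whiskeringLeft _ _ (Type u)).obj F.op :=
  Iso.symm (NatIso.ofComponents (fun Y =>
    Functor.isoWhiskerLeft F.op ((restUnit D).app Y)) (fun g => by
      ext c y
      exact (yonedaEquiv_symm_naturality_right (F.obj c.unop) g y).symm))

lemma IsMorphismOfSites.isSheaf {J : GrothendieckTopology C}
    {K : GrothendieckTopology D} {F : C ⥤ D} (hF : IsMorphismOfSites J K F)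
    (Y : Sheaf K (Type u)) :
    Presheaf.IsSheaf J (((Functor.whiskeringLeft _ _ (Type u)).obj F.op).obj Y.obj) :=
  (Presheaf.isSheaf_of_iso_iff ((restRepr F).app Y.obj)).1
    (hF.isDistributorOfSites.isSheaf_rest Y)

lemma IsMorphismOfSites.preservesFiniteLimits {J : GrothendieckTopology C}
    {K : GrothendieckTopology D} {F : C ⥤ D} (hF : IsMorphismOfSites J K F) :
    PreservesFiniteLimits ((F.op.lan : (Cᵒᵖ ⥤ Type u) ⥤ _) ⋙ presheafToSheaf K (Type u)) := by
  have := hF.isDistributorOfSites.flat.preservesFiniteLimits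
  exact preservesFiniteLimits_of_natIso (Functor.isoWhiskerRight
    ((conjugateIsoEquiv (F.op.lanAdjunction (Type u)) (lextAdj F.toProfunctor)).symm
      (restRepr F).symm) (presheafToSheaf K (Type u)))

end

/-- The system of adjunctions `f_! ⊣ f^*` for morphisms of sites `f`. -/
def flatSystem : SheafSystem.{u} SiteFlat.{u}ᵒᵖ where
  site X := X.unop.site
  L f := f.unop.functor.op.lan
  R f := (Functor.whiskeringLeft _ _ (Type u)).obj f.unop.functor.op
  adj f := f.unop.functor.op.lanAdjunction (Type u)
  isSheaf f Y := IsMorphismOfSites.isSheaf f.unop.mem Y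
  lex f := IsMorphismOfSites.preservesFiniteLimits f.unop.mem
  map₂ {a b f g} η := (CategoryTheory.conjugateEquiv (g.unop.functor.op.lanAdjunction (Type u))
    (f.unop.functor.op.lanAdjunction (Type u))).symm
      ((Functor.whiskeringLeft _ _ (Type u)).map (NatTrans.op η.unop2.nat))
  map₂_id f := by
    rw [Equiv.symm_apply_eq, CategoryTheory.conjugateEquiv_id]
    ext Y c y
    exact ConcreteCategory.congr_hom (Y.map_id _) y
  map₂_comp η θ := by
    rw [Equiv.symm_apply_eq, ← CategoryTheory.conjugateEquiv_comp, Equiv.apply_symm_apply,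
      Equiv.apply_symm_apply]
    ext Y c y
    exact ConcreteCategory.congr_hom (Y.map_comp _ _) y
  id X := NatIso.ofComponents (fun Y => NatIso.ofComponents (fun c => Iso.refl _))
  comp f g := NatIso.ofComponents (fun Y => NatIso.ofComponents (fun c => Iso.refl _))
  whiskerLeft {a b c} f {g h} η := by
    rw [Equiv.apply_symm_apply, Equiv.apply_symm_apply]
    ext Y c y
    rfl
  whiskerRight {a b c f g} η h := by
    rw [Equiv.apply_symm_apply, Equiv.apply_symm_apply]
    ext Y c y
    rfl
  associator {a b c d} f g h := by
    rw [Equiv.apply_symm_apply]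
    ext Y c y
    exact ConcreteCategory.congr_hom (Y.map_id _) y
  leftUnitor {a b} f := by
    rw [Equiv.apply_symm_apply]
    ext Y c y
    exact ConcreteCategory.congr_hom (Y.map_id _) y
  rightUnitor {a b} f := by
    rw [Equiv.apply_symm_apply]
    ext Y c y
    exact ConcreteCategory.congr_hom (Y.map_id _) y

end FlatSystem

section SharpSystem

lemma conjugateEquiv_associator_inv {A B C D : Type*} [Category* A] [Category* B] [Category* C]
    [Category* D] {L₁ : A ⥤ B} {R₁ : B ⥤ A} {L₂ : B ⥤ C} {R₂ : C ⥤ B} {L₃ : C ⥤ D} {R₃ : D ⥤ C}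
    (adj₁ : L₁ ⊣ R₁) (adj₂ : L₂ ⊣ R₂) (adj₃ : L₃ ⊣ R₃) :
    CategoryTheory.conjugateEquiv ((adj₁.comp adj₂).comp adj₃) (adj₁.comp (adj₂.comp adj₃))
      (Functor.associator _ _ _).inv = (Functor.associator _ _ _).inv := by
  rw [← cancel_mono (Functor.associator R₃ R₂ R₁).hom, Iso.inv_hom_id]
  conv_lhs => rw [← conjugateEquiv_associator_hom adj₁ adj₂ adj₃,
    CategoryTheory.conjugateEquiv_comp, Iso.hom_inv_id]
  exact CategoryTheory.conjugateEquiv_id _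

/-- The strict identity `𝟭^* ≅ 𝟭`. -/
def pullId (C : Type u) [SmallCategory C] :
    (Functor.whiskeringLeft _ _ (Type u)).obj (Functor.op (𝟭 C)) ≅ 𝟭 (Cᵒᵖ ⥤ Type u) :=
  NatIso.ofComponents (fun Y => NatIso.ofComponents (fun c => Iso.refl _))

/-- The strict identity `(F ⋙ G)^* ≅ G^* ⋙ F^*`. -/
def pullComp {C D E : Type u} [SmallCategory C] [SmallCategory D] [SmallCategory E] (F : C ⥤ D)
    (G : D ⥤ E) :
    (Functor.whiskeringLeft _ _ (Type u)).obj (Functor.op (F ⋙ G)) ≅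
      (Functor.whiskeringLeft _ _ (Type u)).obj G.op ⋙
        (Functor.whiskeringLeft _ _ (Type u)).obj F.op :=
  NatIso.ofComponents (fun Y => NatIso.ofComponents (fun c => Iso.refl _))

open Limits in
/-- The system of adjunctions `f^* ⊣ f_*` for comorphisms of sites `f`, with `f_*` the right Kan
extension along `f^op`. -/
def sharpSystem : SheafSystem.{u} (Co SiteSharp.{u}) where
  site X := X.unco.site
  L f := (Functor.whiskeringLeft _ _ (Type u)).obj f.unco.functor.op
  R f := f.unco.functor.op.ran
  adj f := f.unco.functor.op.ranAdjunction (Type u)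
  isSheaf {a b} f Y :=
    have : f.unco.functor.IsCocontinuous a.unco.site.J b.unco.site.J := f.unco.mem
    ran_isSheaf_of_isCocontinuous f.unco.functor b.unco.site.J Y
  lex f := comp_preservesFiniteLimits _ _
  map₂ {a b f g} η := (Functor.whiskeringLeft _ _ (Type u)).map (NatTrans.op η.unco.nat)
  map₂_id f := by
    ext Y c y
    exact ConcreteCategory.congr_hom (Y.map_id _) y
  map₂_comp η θ := by
    ext Y c y
    exact ConcreteCategory.congr_hom (Y.map_comp _ _) y
  id X := (conjugateIsoEquiv Adjunction.id ((𝟙 X : X ⟶ X).unco.functor.op.ranAdjunction (Type u)))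
    (pullId X.unco.site.C)
  comp f g := (conjugateIsoEquiv ((g.unco.functor.op.ranAdjunction (Type u)).comp
      (f.unco.functor.op.ranAdjunction (Type u)))
    ((f ≫ g).unco.functor.op.ranAdjunction (Type u)))
    (pullComp f.unco.functor g.unco.functor)
  whiskerLeft {a b c} f {g h} η := by
    rw [CategoryTheory.conjugateIsoEquiv_apply_hom, CategoryTheory.conjugateIsoEquiv_apply_inv,
      ← conjugateEquiv_whiskerRight _ _ (f.unco.functor.op.ranAdjunction (Type u)),
      CategoryTheory.conjugateEquiv_comp, CategoryTheory.conjugateEquiv_comp]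
    congr 1
  whiskerRight {a b c f g} η h := by
    rw [CategoryTheory.conjugateIsoEquiv_apply_hom, CategoryTheory.conjugateIsoEquiv_apply_inv,
      ← conjugateEquiv_whiskerLeft _ _ (h.unco.functor.op.ranAdjunction (Type u)),
      CategoryTheory.conjugateEquiv_comp, CategoryTheory.conjugateEquiv_comp]
    congr 1
  associator {a b c d} f g h := by
    simp only [CategoryTheory.conjugateIsoEquiv_apply_hom,
      CategoryTheory.conjugateIsoEquiv_apply_inv]
    rw [← conjugateEquiv_whiskerRight _ _ (f.unco.functor.op.ranAdjunction (Type u)),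
      ← conjugateEquiv_whiskerLeft _ _ (h.unco.functor.op.ranAdjunction (Type u)),
      ← conjugateEquiv_associator_inv (h.unco.functor.op.ranAdjunction (Type u))
        (g.unco.functor.op.ranAdjunction (Type u)) (f.unco.functor.op.ranAdjunction (Type u)),
      CategoryTheory.conjugateEquiv_comp, CategoryTheory.conjugateEquiv_comp,
      CategoryTheory.conjugateEquiv_comp, CategoryTheory.conjugateEquiv_comp]
    congr 1
    ext Y c y
    exact ConcreteCategory.congr_hom (Y.map_id _) y
  leftUnitor {a b} f := by
    rw [CategoryTheory.conjugateIsoEquiv_apply_hom, CategoryTheory.conjugateIsoEquiv_apply_hom,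
      ← conjugateEquiv_whiskerLeft _ _ (f.unco.functor.op.ranAdjunction (Type u)),
      ← conjugateEquiv_rightUnitor_hom (f.unco.functor.op.ranAdjunction (Type u)),
      CategoryTheory.conjugateEquiv_comp, CategoryTheory.conjugateEquiv_comp]
    congr 1
    ext Y c y
    exact ConcreteCategory.congr_hom (Y.map_id _) y
  rightUnitor {a b} f := by
    rw [CategoryTheory.conjugateIsoEquiv_apply_hom, CategoryTheory.conjugateIsoEquiv_apply_hom,
      ← conjugateEquiv_whiskerRight _ _ (f.unco.functor.op.ranAdjunction (Type u)),
      ← conjugateEquiv_leftUnitor_hom (f.unco.functor.op.ranAdjunction (Type u)),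
      CategoryTheory.conjugateEquiv_comp, CategoryTheory.conjugateEquiv_comp]
    congr 1
    ext Y c y
    exact ConcreteCategory.congr_hom (Y.map_id _) y

end SharpSystem

section Main

/-- The pseudofunctor `Sh` from the dual of the bicategory of distributors of sites to `Top`: a
distributor of sites `H : (C, J) ⇸ (D, K)` is sent to the geometric morphism `Sh(D, K) ⟶ Sh(C, J)`
with inverse image `a_K ∘ lext_H ∘ i_J` and direct image `rest_H`. -/
def sh : SiteDist.{u}ᵒᵖ ⥤ᵖ GrothendieckTopos.{u} := shSystem.toPseudofunctor

/-- The pseudofunctor `Sh : (Site^♭)^op ⟶ Top`: a morphism of sites `f : (C, J) ⟶ (D, K)` is sent to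
the geometric morphism `Sh(D, K) ⟶ Sh(C, J)` with inverse image `a_K ∘ f_! ∘ i_J`, where `f_!` is
left Kan extension along `f^op`, and with direct image the restriction `f^*` along `f^op`. -/
def shFlat : SiteFlat.{u}ᵒᵖ ⥤ᵖ GrothendieckTopos.{u} := flatSystem.toPseudofunctor

/-- The pseudofunctor `C : (Site^♯)^co ⟶ Top`: a comorphism of sites `f : (D, K) ⟶ (C, J)` is sent to
the geometric morphism `Sh(D, K) ⟶ Sh(C, J)` with inverse image `a_K ∘ f^* ∘ i_J`, where `f^*` is
restriction along `f^op`, and with direct image right Kan extension along `f^op`. -/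
def shSharp : Co SiteSharp.{u} ⥤ᵖ GrothendieckTopos.{u} := sharpSystem.toPseudofunctor

section

variable {B C D : Type u} [SmallCategory B] [SmallCategory C] [SmallCategory D]

/-- `D(1, 𝟭) ≅ hom_D`. -/
def reprUnit (D : Type u) [SmallCategory D] : (𝟭 D).toProfunctor ≅ Profunctor.id :=
  NatIso.ofComponents (fun c => NatIso.ofComponents (fun d => Iso.refl _))

/-- `D(1, G ⋙ F) ≅ D(1, F) ⊗ C(1, G)`. -/
def reprTensor (G : B ⥤ C) (F : C ⥤ D) :
    (G ⋙ F).toProfunctor ≅ tensor F.toProfunctor G.toProfunctor :=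
  Iso.symm (NatIso.ofComponents (fun b => (tensorUnit F.toProfunctor).app (G.obj b))
    (fun f => (tensorUnit F.toProfunctor).hom.naturality (G.map f)))

/-- `D(𝟭, 1) ≅ hom_D`. -/
def coreprUnit (D : Type u) [SmallCategory D] : (𝟭 D).toProfunctorRev ≅ Profunctor.id :=
  NatIso.ofComponents (fun c => NatIso.ofComponents (fun d => Iso.refl _))

/-- `D(F ⋙ G, 1) ≅ C(F, 1) ⊗ D(G, 1)`. -/
def coreprTensor (F : B ⥤ C) (G : C ⥤ D) :
    (F ⋙ G).toProfunctorRev ≅ tensor F.toProfunctorRev G.toProfunctorRev :=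
  Iso.symm (NatIso.ofComponents (fun d => NatIso.ofComponents (fun b =>
      { hom := ↾(LextObj.lift (H := F.toProfunctorRev) (X := G.toProfunctorRev.obj d)
          (fun c (x : F.obj b.unop ⟶ c) (s : G.obj c ⟶ d) => (G.map x ≫ s : G.obj (F.obj b.unop) ⟶ d))
          (fun {c c'} f (x : F.obj b.unop ⟶ c) (s : G.obj c' ⟶ d) => by
            change G.map x ≫ G.map f ≫ s = G.map (x ≫ f) ≫ s
            rw [G.map_comp, Category.assoc]))
        inv := ↾(fun (t : G.obj (F.obj b.unop) ⟶ d) => LextObj.mk (H := F.toProfunctorRev)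
          (X := G.toProfunctorRev.obj d) (𝟙 (F.obj b.unop)) t)
        hom_inv_id := by
          ext z; induction z using LextObj.ind with
          | h c x s =>
            exact (LextObj.sound (H := F.toProfunctorRev) (X := G.toProfunctorRev.obj d) x
              (𝟙 (F.obj b.unop)) s).trans
                (congrArg (LextObj.mk (H := F.toProfunctorRev) · s) (Category.id_comp (obj := C) x))
        inv_hom_id := by
          ext t
          exact (congrArg (· ≫ (show G.obj (F.obj b.unop) ⟶ d from t)) (G.map_id _)).trans
            (Category.id_comp _) })
      (fun {b b'} f => by
        ext z; induction z using LextObj.ind with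
        | h c x s =>
          exact (congrArg (· ≫ (show G.obj c ⟶ d from s)) (G.map_comp (F.map f.unop) x)).trans
            (Category.assoc _ _ _)))
    (fun {d d'} f => by
      ext b z; induction z using LextObj.ind with
      | h c x s => exact (Category.assoc (G.map x) (show G.obj c ⟶ d from s) f).symm))

end

/-- The right representable construction on 1-cells and 2-cells: a morphism of sites
`f : (C, J) ⟶ (D, K)` is sent to `D(1, f) : (C, J) ⇸ (D, K)`, and `φ : f ⟶ g` is sent to
`D(1, φ) : D(1, f) ⟶ D(1, g)`. -/
def representable (h : ∀ (X Y : SmallSite.{u}) (F : X.C ⥤ Y.C), IsMorphismOfSites X.J Y.J F →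
    IsDistributorOfSites X.J Y.J F.toProfunctor) :
    PrelaxFunctor SiteFlat.{u}ᵒᵖ SiteDist.{u}ᵒᵖ where
  obj X := op ⟨X.unop.site⟩
  map {X Y} f := Quiver.Hom.op (X := SiteDist.mk Y.unop.site) (Y := SiteDist.mk X.unop.site)
    ⟨f.unop.functor.toProfunctor, h _ _ _ f.unop.mem⟩
  map₂ η := Bicategory.Opposite.op2 (distMk (reprMap η.unop2.nat))
  map₂_id f := by
    refine congrArg Bicategory.Opposite.op2 (siteDist_hom_ext ?_)
    ext c d x
    exact Category.comp_id (X := d.unop) (Y := f.unop.functor.obj c) x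
  map₂_comp {X Y f g h} η θ := by
    refine congrArg Bicategory.Opposite.op2 (siteDist_hom_ext ?_)
    ext c d x
    exact (Category.assoc (show d.unop ⟶ f.unop.functor.obj c from x) (η.unop2.nat.app c)
      (θ.unop2.nat.app c)).symm

/-- `D(1, 𝟭) ≅ hom_D` in the bicategory of distributors of sites. -/
def representableId (h : ∀ (X Y : SmallSite.{u}) (F : X.C ⥤ Y.C), IsMorphismOfSites X.J Y.J F →
    IsDistributorOfSites X.J Y.J F.toProfunctor) (X : SiteFlat.{u}ᵒᵖ) :
    (representable h).map (𝟙 X) ≅ 𝟙 ((representable h).obj X) :=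
  Iso.op2_unop (distIso (reprUnit X.unop.site.C))

/-- `D(1, G ⋙ F) ≅ D(1, F) ⊗ C(1, G)` in the bicategory of distributors of sites. -/
def representableComp (h : ∀ (X Y : SmallSite.{u}) (F : X.C ⥤ Y.C), IsMorphismOfSites X.J Y.J F →
    IsDistributorOfSites X.J Y.J F.toProfunctor) {X Y Z : SiteFlat.{u}ᵒᵖ} (f : X ⟶ Y) (g : Y ⟶ Z) :
    (representable h).map (f ≫ g) ≅ (representable h).map f ≫ (representable h).map g :=
  Iso.op2_unop (distIso (reprTensor g.unop.functor f.unop.functor))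

/-- The left representable construction on 1-cells and 2-cells: a comorphism of sites
`f : (D, K) ⟶ (C, J)` is sent to `C(f, 1) : (C, J) ⇸ (D, K)`, and `φ : f ⟶ g` is sent to
`C(φ, 1) : C(g, 1) ⟶ C(f, 1)`. -/
def corepresentable (h : ∀ (X Y : SmallSite.{u}) (F : X.C ⥤ Y.C), IsComorphismOfSites X.J Y.J F →
    IsDistributorOfSites Y.J X.J F.toProfunctorRev) :
    PrelaxFunctor (Co SiteSharp.{u}) SiteDist.{u}ᵒᵖ where
  obj X := op ⟨X.unco.site⟩
  map {X Y} f := Quiver.Hom.op (X := SiteDist.mk Y.unco.site) (Y := SiteDist.mk X.unco.site)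
    ⟨f.unco.functor.toProfunctorRev, h _ _ _ f.unco.mem⟩
  map₂ η := Bicategory.Opposite.op2 (distMk (coreprMap η.unco.nat))
  map₂_id f := by
    refine congrArg Bicategory.Opposite.op2 (siteDist_hom_ext ?_)
    ext c d x
    exact Category.id_comp (X := f.unco.functor.obj d.unop) (Y := c) x
  map₂_comp {X Y f g h} η θ := by
    refine congrArg Bicategory.Opposite.op2 (siteDist_hom_ext ?_)
    ext c d x
    exact Category.assoc (θ.unco.nat.app d.unop) (η.unco.nat.app d.unop)
      (show f.unco.functor.obj d.unop ⟶ c from x)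

/-- `D(𝟭, 1) ≅ hom_D` in the bicategory of distributors of sites. -/
def corepresentableId (h : ∀ (X Y : SmallSite.{u}) (F : X.C ⥤ Y.C), IsComorphismOfSites X.J Y.J F →
    IsDistributorOfSites Y.J X.J F.toProfunctorRev) (X : Co SiteSharp.{u}) :
    (corepresentable h).map (𝟙 X) ≅ 𝟙 ((corepresentable h).obj X) :=
  Iso.op2_unop (distIso (coreprUnit X.unco.site.C))

/-- `D(F ⋙ G, 1) ≅ C(F, 1) ⊗ D(G, 1)` in the bicategory of distributors of sites. -/
def corepresentableComp (h : ∀ (X Y : SmallSite.{u}) (F : X.C ⥤ Y.C), IsComorphismOfSites X.J Y.J F →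
    IsDistributorOfSites Y.J X.J F.toProfunctorRev) {X Y Z : Co SiteSharp.{u}} (f : X ⟶ Y)
    (g : Y ⟶ Z) : (corepresentable h).map (f ≫ g) ≅ (corepresentable h).map f ≫ (corepresentable h).map g :=
  Iso.op2_unop (distIso (coreprTensor f.unco.functor g.unco.functor))

universe w₁ w₂ v₁ v₂ u₁ u₂

/-- The coherence laws of a pseudofunctor, for an assignment `P` on objects, 1-cells and 2-cells
with given compatibility isomorphisms. -/
structure IsCoherent {A : Type u₁} [Bicategory.{w₁, v₁} A] {B : Type u₂} [Bicategory.{w₂, v₂} B]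
    (P : PrelaxFunctor A B) (mapId : ∀ a : A, P.map (𝟙 a) ≅ 𝟙 (P.obj a))
    (mapComp : ∀ {a b c : A} (f : a ⟶ b) (g : b ⟶ c), P.map (f ≫ g) ≅ P.map f ≫ P.map g) :
    Prop where
  map₂_whisker_left {a b c : A} (f : a ⟶ b) {g h : b ⟶ c} (η : g ⟶ h) :
    P.map₂ (f ◁ η) = (mapComp f g).hom ≫ P.map f ◁ P.map₂ η ≫ (mapComp f h).inv
  map₂_whisker_right {a b c : A} {f g : a ⟶ b} (η : f ⟶ g) (h : b ⟶ c) :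
    P.map₂ (η ▷ h) = (mapComp f h).hom ≫ P.map₂ η ▷ P.map h ≫ (mapComp g h).inv
  map₂_associator {a b c d : A} (f : a ⟶ b) (g : b ⟶ c) (h : c ⟶ d) :
    P.map₂ (α_ f g h).hom = (mapComp (f ≫ g) h).hom ≫ (mapComp f g).hom ▷ P.map h ≫
      (α_ (P.map f) (P.map g) (P.map h)).hom ≫ P.map f ◁ (mapComp g h).inv ≫
        (mapComp f (g ≫ h)).inv
  map₂_left_unitor {a b : A} (f : a ⟶ b) :
    P.map₂ (λ_ f).hom = (mapComp (𝟙 a) f).hom ≫ (mapId a).hom ▷ P.map f ≫ (λ_ (P.map f)).hom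
  map₂_right_unitor {a b : A} (f : a ⟶ b) :
    P.map₂ (ρ_ f).hom = (mapComp f (𝟙 b)).hom ≫ P.map f ◁ (mapId b).hom ≫ (ρ_ (P.map f)).hom

/-- The pseudofunctor with the given coherent data. -/
def IsCoherent.toPseudofunctor {A : Type u₁} [Bicategory.{w₁, v₁} A] {B : Type u₂}
    [Bicategory.{w₂, v₂} B] {P : PrelaxFunctor A B} {mapId : ∀ a : A, P.map (𝟙 a) ≅ 𝟙 (P.obj a)}
    {mapComp : ∀ {a b c : A} (f : a ⟶ b) (g : b ⟶ c), P.map (f ≫ g) ≅ P.map f ≫ P.map g}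
    (h : IsCoherent P mapId mapComp) : A ⥤ᵖ B where
  toPrelaxFunctor := P
  mapId := mapId
  mapComp := mapComp
  map₂_whisker_left := h.map₂_whisker_left
  map₂_whisker_right := h.map₂_whisker_right
  map₂_associator := h.map₂_associator
  map₂_left_unitor := h.map₂_left_unitor
  map₂_right_unitor := h.map₂_right_unitor

end Main

end

end SiteDistributors

open SiteDistributors

/-!
The heteromorphisms `F d ⟶ c` of a corepresentable `C(F, 1)` all factor through `𝟙 (F d)`. Hence for
a comorphism of sites the flatness sieves are maximal, and cover-distribution is the cover-lifting
property applied to a pulled back sieve (`IsComorphismOfSites.isDistributorOfSites`). The coherence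
laws of the two pseudofunctors `R` and `L` are equations between transformations out of a
representable or corepresentable distributor; evaluated at a heteromorphism, the coends involved
compute, and each law becomes an identity between composites in one category.

A geometric transformation is determined by its mate between direct images, and the direct images
at hand are restrictions to sheaves of functors between presheaf categories. On presheaves, the
Yoneda lemma gives `rest_{D(1, f)} ≅ f^*` (`restRepr`). The co-Yoneda lemma gives
`lext_{C(f, 1)} ≅ f^*` (`lextCorepr`), so that passing to right adjoints
`ran_{f^op} ≅ rest_{C(f, 1)}` (`ranRest`). These isomorphisms are the naturality constraints of the
two transformations with identity components. The axioms of a strong transformation with identity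
components are compatibilities with 2-cells, units and composites (`iconCell_naturality`,
`iconCell_id`, `iconCell_comp`), which can be tested on the right adjoints between presheaves
(`sheafGeomIso_naturality`, `sheafGeomIso_id`, `sheafGeomIso_comp`). In the representable case they
are checked on elements. In the corepresentable case the right Kan extensions are known only through
their adjunctions, so every map is written as the mate of a map between left adjoints, where the
coends compute again; this uses that `restUnit` and `restTensor` are the mates of `lextUnit` and
`lextTensor`.
-/

namespace SiteDistributors

/-! ### Corepresentable distributors of sites -/

/-- The corepresentable of a comorphism of sites is a distributor of sites. -/
lemma IsComorphismOfSites.isDistributorOfSites {C D : Type u} [SmallCategory C] [SmallCategory D]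
    {J : GrothendieckTopology C} {K : GrothendieckTopology D} {F : D ⥤ C}
    (hF : IsComorphismOfSites K J F) : IsDistributorOfSites J K F.toProfunctorRev where
  coverDistributing d c x S hS := by
    refine K.superset_covering (fun d' v hv => ?_)
      (hF.cover_lift (J.pullback_stable (show F.obj d ⟶ c from x) hS))
    exact ⟨F.obj d', _, hv, 𝟙 (F.obj d'), Category.id_comp (obj := C) _⟩
  flat :=
    { inhab := fun d =>
        K.superset_covering (fun d' _ _ => ⟨F.obj d', ⟨𝟙 (F.obj d')⟩⟩) (K.top_mem d)
      span := fun {d c c'} x x' =>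
        K.superset_covering (fun d' v _ => ⟨F.obj d', F.map v ≫ (show F.obj d ⟶ c from x),
          F.map v ≫ (show F.obj d ⟶ c' from x'), 𝟙 (F.obj d'),
          Category.id_comp (obj := C) _, Category.id_comp (obj := C) _⟩) (K.top_mem d)
      eq := fun {d c c'} f f' x h =>
        K.superset_covering (fun d' v _ => ⟨F.obj d', F.map v ≫ (show F.obj d ⟶ c' from x),
          𝟙 (F.obj d'), (Category.assoc _ _ _).trans
            ((congrArg (F.map v ≫ ·) h).trans (Category.assoc _ _ _).symm),
          Category.id_comp (obj := C) _⟩) (K.top_mem d) }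

/-! ### Coherence of the representable and corepresentable pseudofunctors -/

/-- Each law is evaluated at a heteromorphism `y`. The composition constraint sends `y` to the class
of `(y, 𝟙)` in the coend, and its inverse composes the two entries of a pair, so that the law
reduces to an equation between composites of `y` with images of identities and components. -/
lemma isCoherent_representable
    (hR : ∀ (X Y : SmallSite.{u}) (F : X.C ⥤ Y.C), IsMorphismOfSites X.J Y.J F →
      IsDistributorOfSites X.J Y.J F.toProfunctor) :
    IsCoherent (representable hR) (representableId hR) (representableComp hR) where
  map₂_whisker_left {a b c} f {g h} η := by
    refine congrArg Bicategory.Opposite.op2 (siteDist_hom_ext ?_)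
    ext c d x
    exact (show ∀ y : d.unop ⟶ f.unop.functor.obj (g.unop.functor.obj c),
      y ≫ f.unop.functor.map (η.unop2.nat.app c) =
        y ≫ f.unop.functor.map (𝟙 _ ≫ η.unop2.nat.app c) by intro y; simp) x
  map₂_whisker_right {a b c f g} η h := by
    refine congrArg Bicategory.Opposite.op2 (siteDist_hom_ext ?_)
    ext c d x
    exact (show ∀ y : d.unop ⟶ f.unop.functor.obj (h.unop.functor.obj c),
      y ≫ η.unop2.nat.app (h.unop.functor.obj c) =
        (y ≫ η.unop2.nat.app (h.unop.functor.obj c)) ≫ g.unop.functor.map (𝟙 _)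
      by intro y; simp) x
  map₂_associator {a b c d} f g h := by
    refine congrArg Bicategory.Opposite.op2 (siteDist_hom_ext ?_)
    ext c d x
    exact (show ∀ y : d.unop ⟶ f.unop.functor.obj (g.unop.functor.obj (h.unop.functor.obj c)),
      y ≫ 𝟙 _ = y ≫ f.unop.functor.map (𝟙 _ ≫ g.unop.functor.map (𝟙 _)) by intro y; simp) x
  map₂_left_unitor {a b} f := by
    refine congrArg Bicategory.Opposite.op2 (siteDist_hom_ext ?_)
    ext c d x
    rfl
  map₂_right_unitor {a b} f := by
    refine congrArg Bicategory.Opposite.op2 (siteDist_hom_ext ?_)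
    ext c d x
    exact (show ∀ y : d.unop ⟶ f.unop.functor.obj c,
      y ≫ 𝟙 _ = y ≫ f.unop.functor.map (𝟙 _) by intro y; simp) x

/-- As for representables, except that the composition constraint sends a heteromorphism `y` to the
class of `(𝟙, y)`. -/
lemma isCoherent_corepresentable
    (hL : ∀ (X Y : SmallSite.{u}) (F : X.C ⥤ Y.C), IsComorphismOfSites X.J Y.J F →
      IsDistributorOfSites Y.J X.J F.toProfunctorRev) :
    IsCoherent (corepresentable hL) (corepresentableId hL) (corepresentableComp hL) where
  map₂_whisker_left {a b c} f {g h} η := by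
    refine congrArg Bicategory.Opposite.op2 (siteDist_hom_ext ?_)
    ext c d x
    exact (show ∀ y : g.unco.functor.obj (f.unco.functor.obj d.unop) ⟶ c,
      η.unco.nat.app (f.unco.functor.obj d.unop) ≫ y =
        h.unco.functor.map (𝟙 _) ≫ η.unco.nat.app (f.unco.functor.obj d.unop) ≫ y
      by intro y; simp) x
  map₂_whisker_right {a b c f g} η h := by
    refine congrArg Bicategory.Opposite.op2 (siteDist_hom_ext ?_)
    ext c d x
    exact (show ∀ y : h.unco.functor.obj (f.unco.functor.obj d.unop) ⟶ c,
      h.unco.functor.map (η.unco.nat.app d.unop) ≫ y =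
        h.unco.functor.map (η.unco.nat.app d.unop ≫ 𝟙 _) ≫ y by intro y; simp) x
  map₂_associator {a b c d} f g h := by
    refine congrArg Bicategory.Opposite.op2 (siteDist_hom_ext ?_)
    ext c d x
    exact (show ∀ y : h.unco.functor.obj (g.unco.functor.obj (f.unco.functor.obj d.unop)) ⟶ c,
      𝟙 _ ≫ y = h.unco.functor.map (g.unco.functor.map (𝟙 _)) ≫ h.unco.functor.map (𝟙 _) ≫ y
      by intro y; simp) x
  map₂_left_unitor {a b} f := by
    refine congrArg Bicategory.Opposite.op2 (siteDist_hom_ext ?_)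
    ext c d x
    exact (show ∀ y : f.unco.functor.obj d.unop ⟶ c,
      𝟙 _ ≫ y = f.unco.functor.map (𝟙 _) ≫ y by intro y; simp) x
  map₂_right_unitor {a b} f := by
    refine congrArg Bicategory.Opposite.op2 (siteDist_hom_ext ?_)
    ext c d x
    rfl

/-! ### Strong transformations with identity components -/

section

universe w v u'

variable {B : Type u'} [Bicategory.{w, v} B] {a b c : B}

/-- An invertible 2-cell `f ≅ f'`, read as a naturality square whose two vertical sides are identity
1-cells. -/
def iconCell {f f' : a ⟶ b} (e : f ≅ f') : f ≫ 𝟙 b ≅ 𝟙 a ≫ f' := ρ_ f ≪≫ e ≪≫ (λ_ f').symm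

/-- The naturality axiom of a strong transformation with identity components. -/
lemma iconCell_naturality {f g f' g' : a ⟶ b} (η : f ⟶ g) (η' : f' ⟶ g') (e : f ≅ f')
    (e' : g ≅ g') (h : η ≫ e'.hom = e.hom ≫ η') :
    η ▷ 𝟙 b ≫ (iconCell e').hom = (iconCell e).hom ≫ 𝟙 a ◁ η' := by
  simp [iconCell, reassoc_of% h]

/-- The unit axiom of a strong transformation with identity components. -/
lemma iconCell_id {f f' : a ⟶ a} (e : f ≅ f') (i : f ⟶ 𝟙 a) (i' : f' ⟶ 𝟙 a)
    (h : i = e.hom ≫ i') :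
    (iconCell e).hom ≫ 𝟙 a ◁ i' = i ▷ 𝟙 a ≫ (λ_ (𝟙 a)).hom ≫ (ρ_ (𝟙 a)).inv := by
  simp [iconCell, h, unitors_equal, unitors_inv_equal]

/-- The composition axiom of a strong transformation with identity components. -/
lemma iconCell_comp {f f' : a ⟶ b} {g g' : b ⟶ c} {k k' : a ⟶ c} (e : f ≅ f') (d : g ≅ g')
    (t : k ≅ k') (m : k ⟶ f ≫ g) (m' : k' ⟶ f' ≫ g')
    (h : t.hom ≫ m' = m ≫ f ◁ d.hom ≫ e.hom ▷ g') :
    (iconCell t).hom ≫ 𝟙 a ◁ m' = m ▷ 𝟙 c ≫ (α_ _ _ _).hom ≫ f ◁ (iconCell d).hom ≫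
        (α_ _ _ _).inv ≫ (iconCell e).hom ▷ g' ≫ (α_ _ _ _).hom := by
  simp only [iconCell, Iso.trans_hom, Iso.symm_hom, Category.assoc, id_whiskerLeft,
    Iso.inv_hom_id_assoc, reassoc_of% h, Bicategory.whiskerLeft_comp, comp_whiskerRight]
  bicategory

end

noncomputable section

/-! ### Geometric transformations from isomorphisms between right adjoints on presheaves -/

section

variable {B C D : Type u} [SmallCategory B] [SmallCategory C] [SmallCategory D]
  {I : GrothendieckTopology B} {J : GrothendieckTopology C} {K : GrothendieckTopology D}

section

variable {L L' : (Cᵒᵖ ⥤ Type u) ⥤ (Dᵒᵖ ⥤ Type u)}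
    {R R' : (Dᵒᵖ ⥤ Type u) ⥤ (Cᵒᵖ ⥤ Type u)} {adj : L ⊣ R} {adj' : L' ⊣ R'}
    {hR : ∀ Y : Sheaf K (Type u), Presheaf.IsSheaf J (R.obj Y.obj)}
    {hR' : ∀ Y : Sheaf K (Type u), Presheaf.IsSheaf J (R'.obj Y.obj)}
    {hL : Limits.PreservesFiniteLimits (L ⋙ presheafToSheaf K (Type u))}
    {hL' : Limits.PreservesFiniteLimits (L' ⋙ presheafToSheaf K (Type u))}

/-- The invertible geometric transformation between geometric morphisms of sheaf toposes given by an
isomorphism between the right adjoints on presheaves. As a geometric transformation points in the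
direction of the inverse images, the isomorphism of right adjoints points backwards. -/
def sheafGeomIso (e : R' ≅ R) : sheafGeom adj hR hL ≅ sheafGeom adj' hR' hL' :=
  geomIsoOfDirect
    { hom := sheafRightMap e.hom hR' hR
      inv := sheafRightMap e.inv hR hR'
      hom_inv_id := NatTrans.ext (funext fun Y => Sheaf.hom_ext (congr_app e.hom_inv_id Y.obj))
      inv_hom_id := NatTrans.ext (funext fun Y => Sheaf.hom_ext (congr_app e.inv_hom_id Y.obj)) }

lemma onDirect_sheafGeomIso_hom (e : R' ≅ R) :
    onDirect (sheafGeomIso (adj := adj) (adj' := adj') (hR := hR) (hR' := hR') (hL := hL)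
      (hL' := hL') e).hom = sheafRightMap e.hom hR' hR := onDirect_geomIsoOfDirect_hom _

end

/-- Compatibility of `sheafGeomIso` with 2-cells can be tested on the right adjoints between
presheaves. -/
lemma sheafGeomIso_naturality {L₁ L₂ L₁' L₂' : (Cᵒᵖ ⥤ Type u) ⥤ (Dᵒᵖ ⥤ Type u)}
    {R₁ R₂ R₁' R₂' : (Dᵒᵖ ⥤ Type u) ⥤ (Cᵒᵖ ⥤ Type u)} {adj₁ : L₁ ⊣ R₁} {adj₂ : L₂ ⊣ R₂}
    {adj₁' : L₁' ⊣ R₁'} {adj₂' : L₂' ⊣ R₂'}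
    {hR₁ : ∀ Y : Sheaf K (Type u), Presheaf.IsSheaf J (R₁.obj Y.obj)}
    {hR₂ : ∀ Y : Sheaf K (Type u), Presheaf.IsSheaf J (R₂.obj Y.obj)}
    {hR₁' : ∀ Y : Sheaf K (Type u), Presheaf.IsSheaf J (R₁'.obj Y.obj)}
    {hR₂' : ∀ Y : Sheaf K (Type u), Presheaf.IsSheaf J (R₂'.obj Y.obj)}
    {hL₁ : Limits.PreservesFiniteLimits (L₁ ⋙ presheafToSheaf K (Type u))}
    {hL₂ : Limits.PreservesFiniteLimits (L₂ ⋙ presheafToSheaf K (Type u))}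
    {hL₁' : Limits.PreservesFiniteLimits (L₁' ⋙ presheafToSheaf K (Type u))}
    {hL₂' : Limits.PreservesFiniteLimits (L₂' ⋙ presheafToSheaf K (Type u))}
    (α : L₁ ⟶ L₂) (α' : L₁' ⟶ L₂') (e₁ : R₁' ≅ R₁) (e₂ : R₂' ≅ R₂)
    (h : CategoryTheory.conjugateEquiv adj₂' adj₁' α' ≫ e₁.hom =
      e₂.hom ≫ CategoryTheory.conjugateEquiv adj₂ adj₁ α) :
    (sheafGeomMap α : sheafGeom adj₁ hR₁ hL₁ ⟶ sheafGeom adj₂ hR₂ hL₂) ≫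
        (sheafGeomIso e₂ : _ ≅ sheafGeom adj₂' hR₂' hL₂').hom =
      (sheafGeomIso e₁ : _ ≅ sheafGeom adj₁' hR₁' hL₁').hom ≫ sheafGeomMap α' := by
  apply onDirect_ext
  rw [onDirect_comp, onDirect_comp, onDirect_sheafGeomIso_hom, onDirect_sheafGeomIso_hom,
    onDirect_sheafGeomMap, onDirect_sheafGeomMap]
  exact NatTrans.ext (funext fun Y => Sheaf.hom_ext (congr_app h Y.obj).symm)

/-- Compatibility of `sheafGeomIso` with unit constraints can be tested on the right adjoints
between presheaves. The constraints `k` and `k'` are described by their direct images `i` and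
`i'`. -/
lemma sheafGeomIso_id {L₁ L₂ L' : (Cᵒᵖ ⥤ Type u) ⥤ (Cᵒᵖ ⥤ Type u)}
    {R₁ R₂ R' : (Cᵒᵖ ⥤ Type u) ⥤ (Cᵒᵖ ⥤ Type u)} {adj₁ : L₁ ⊣ R₁} {adj₂ : L₂ ⊣ R₂}
    {adj' : L' ⊣ R'}
    {hR₁ : ∀ Y : Sheaf J (Type u), Presheaf.IsSheaf J (R₁.obj Y.obj)}
    {hR₂ : ∀ Y : Sheaf J (Type u), Presheaf.IsSheaf J (R₂.obj Y.obj)}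
    {hR' : ∀ Y : Sheaf J (Type u), Presheaf.IsSheaf J (R'.obj Y.obj)}
    {hL₁ : Limits.PreservesFiniteLimits (L₁ ⋙ presheafToSheaf J (Type u))}
    {hL₂ : Limits.PreservesFiniteLimits (L₂ ⋙ presheafToSheaf J (Type u))}
    {hL' : Limits.PreservesFiniteLimits (L' ⋙ presheafToSheaf J (Type u))}
    (α : L₁ ⟶ L₂) (e : R' ≅ R₁) (i : 𝟭 _ ⟶ R₂) (i' : 𝟭 _ ⟶ R')
    (k : sheafGeom adj₂ hR₂ hL₂ ⟶ 𝟙 (sheafTopos J))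
    (k' : sheafGeom adj' hR' hL' ⟶ 𝟙 (sheafTopos J))
    (hk : ∀ Y : Sheaf J (Type u), ((onDirect k).app Y).hom = i.app Y.obj)
    (hk' : ∀ Y : Sheaf J (Type u), ((onDirect k').app Y).hom = i'.app Y.obj)
    (h : i ≫ CategoryTheory.conjugateEquiv adj₂ adj₁ α = i' ≫ e.hom) :
    (sheafGeomMap α : sheafGeom adj₁ hR₁ hL₁ ⟶ sheafGeom adj₂ hR₂ hL₂) ≫ k =
      (sheafGeomIso e : _ ≅ sheafGeom adj' hR' hL').hom ≫ k' := by
  apply onDirect_ext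
  rw [onDirect_comp, onDirect_comp, onDirect_sheafGeomIso_hom, onDirect_sheafGeomMap]
  refine NatTrans.ext (funext fun Y => Sheaf.hom_ext ?_)
  refine (congrArg (· ≫ _) (hk Y)).trans (Eq.trans ?_ (congrArg (· ≫ _) (hk' Y)).symm)
  exact congr_app h Y.obj

/-- Compatibility of `sheafGeomIso` with composition constraints can be tested on the right adjoints
between presheaves. The constraints `k` and `k'` are described by their direct images `m` and
`m'`. -/
lemma sheafGeomIso_comp {Lf Lf' : (Cᵒᵖ ⥤ Type u) ⥤ (Dᵒᵖ ⥤ Type u)}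
    {Rf Rf' : (Dᵒᵖ ⥤ Type u) ⥤ (Cᵒᵖ ⥤ Type u)} {Lg Lg' : (Bᵒᵖ ⥤ Type u) ⥤ (Cᵒᵖ ⥤ Type u)}
    {Rg Rg' : (Cᵒᵖ ⥤ Type u) ⥤ (Bᵒᵖ ⥤ Type u)} {L₁ L₂ L' : (Bᵒᵖ ⥤ Type u) ⥤ (Dᵒᵖ ⥤ Type u)}
    {R₁ R₂ R' : (Dᵒᵖ ⥤ Type u) ⥤ (Bᵒᵖ ⥤ Type u)}
    {adjf : Lf ⊣ Rf} {adjf' : Lf' ⊣ Rf'} {adjg : Lg ⊣ Rg} {adjg' : Lg' ⊣ Rg'}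
    {adj₁ : L₁ ⊣ R₁} {adj₂ : L₂ ⊣ R₂} {adj' : L' ⊣ R'}
    {hRf : ∀ Y : Sheaf K (Type u), Presheaf.IsSheaf J (Rf.obj Y.obj)}
    {hRf' : ∀ Y : Sheaf K (Type u), Presheaf.IsSheaf J (Rf'.obj Y.obj)}
    {hRg : ∀ Y : Sheaf J (Type u), Presheaf.IsSheaf I (Rg.obj Y.obj)}
    {hRg' : ∀ Y : Sheaf J (Type u), Presheaf.IsSheaf I (Rg'.obj Y.obj)}
    {hR₁ : ∀ Y : Sheaf K (Type u), Presheaf.IsSheaf I (R₁.obj Y.obj)}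
    {hR₂ : ∀ Y : Sheaf K (Type u), Presheaf.IsSheaf I (R₂.obj Y.obj)}
    {hR' : ∀ Y : Sheaf K (Type u), Presheaf.IsSheaf I (R'.obj Y.obj)}
    {hLf : Limits.PreservesFiniteLimits (Lf ⋙ presheafToSheaf K (Type u))}
    {hLf' : Limits.PreservesFiniteLimits (Lf' ⋙ presheafToSheaf K (Type u))}
    {hLg : Limits.PreservesFiniteLimits (Lg ⋙ presheafToSheaf J (Type u))}
    {hLg' : Limits.PreservesFiniteLimits (Lg' ⋙ presheafToSheaf J (Type u))}
    {hL₁ : Limits.PreservesFiniteLimits (L₁ ⋙ presheafToSheaf K (Type u))}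
    {hL₂ : Limits.PreservesFiniteLimits (L₂ ⋙ presheafToSheaf K (Type u))}
    {hL' : Limits.PreservesFiniteLimits (L' ⋙ presheafToSheaf K (Type u))}
    (α : L₁ ⟶ L₂) (ef : Rf' ≅ Rf) (eg : Rg' ≅ Rg) (e : R' ≅ R₁)
    (m : Rf ⋙ Rg ⟶ R₂) (m' : Rf' ⋙ Rg' ⟶ R')
    (k : sheafGeom adj₂ hR₂ hL₂ ⟶ sheafGeom adjf hRf hLf ≫ sheafGeom adjg hRg hLg)
    (k' : sheafGeom adj' hR' hL' ⟶ sheafGeom adjf' hRf' hLf' ≫ sheafGeom adjg' hRg' hLg')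
    (hk : ∀ Y : Sheaf K (Type u), ((onDirect k).app Y).hom = m.app Y.obj)
    (hk' : ∀ Y : Sheaf K (Type u), ((onDirect k').app Y).hom = m'.app Y.obj)
    (h : m' ≫ e.hom = Functor.whiskerRight ef.hom Rg' ≫ Functor.whiskerLeft Rf eg.hom ≫ m ≫
      CategoryTheory.conjugateEquiv adj₂ adj₁ α) :
    (sheafGeomIso e : sheafGeom adj₁ hR₁ hL₁ ≅ sheafGeom adj' hR' hL').hom ≫ k' =
      (sheafGeomMap α ≫ k) ≫ sheafGeom adjf hRf hLf ◁
        (sheafGeomIso eg : sheafGeom adjg hRg hLg ≅ sheafGeom adjg' hRg' hLg').hom ≫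
        (sheafGeomIso ef : sheafGeom adjf hRf hLf ≅ sheafGeom adjf' hRf' hLf').hom ▷
          sheafGeom adjg' hRg' hLg' := by
  apply onDirect_ext
  rw [onDirect_comp, onDirect_comp, onDirect_comp, onDirect_comp, onDirect_whiskerLeft,
    onDirect_whiskerRight, onDirect_sheafGeomIso_hom, onDirect_sheafGeomIso_hom,
    onDirect_sheafGeomIso_hom, onDirect_sheafGeomMap, Category.assoc]
  refine NatTrans.ext (funext fun Y => Sheaf.hom_ext ?_)
  refine (congrArg (· ≫ _) (hk' Y)).trans ((congr_app h Y.obj).trans ?_)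
  exact (congrArg (fun t => (_ ≫ (_ ≫ (t ≫ _)))) (hk Y)).symm

end

section

universe w v v'

variable {B : Type v'} [Bicategory.{w, v} B] (S : SheafSystem.{u, w, v} B)

lemma SheafSystem.onDirect_geomId_app (a : B) (Y : Sheaf (S.site a).J (Type u)) :
    ((onDirect (S.geomId a).hom).app Y).hom = (S.id a).hom.app Y.obj := by
  rw [S.onDirect_geomId_hom]
  rfl

lemma SheafSystem.onDirect_geomComp_app {a b c : B} (f : a ⟶ b) (g : b ⟶ c)
    (Y : Sheaf (S.site a).J (Type u)) :
    ((onDirect (S.geomComp f g).hom).app Y).hom = (S.comp f g).hom.app Y.obj := by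
  rw [S.onDirect_geomComp_hom]
  rfl

end

section

variable {B C D : Type u} [SmallCategory B] [SmallCategory C] [SmallCategory D]

/-! ### Restriction along a representable distributor -/

/-- Naturality of `restRepr` in the functor. -/
lemma restRepr_naturality {F G : C ⥤ D} (φ : F ⟶ G) :
    (Functor.whiskeringLeft _ _ (Type u)).map (NatTrans.op φ) ≫ (restRepr F).inv =
      (restRepr G).inv ≫ restMap (reprMap φ) := by
  ext Y c y
  exact (yonedaEquiv_symm_naturality_left (φ.app c.unop) Y y).symm

/-- The unit constraint of `flatSystem` corresponds under `restRepr` to the Yoneda isomorphism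
`restUnit`. -/
lemma restRepr_unit :
    (restUnit D).hom ≫ restMap (reprUnit D).hom =
      (pullId D).inv ≫ (restRepr (𝟭 D)).inv := by
  ext Y c y
  rfl

/-- The composition constraint of `flatSystem` corresponds under `restRepr` to `restTensor`. -/
lemma restRepr_tensor (G : B ⥤ C) (F : C ⥤ D) :
    (pullComp G F).inv ≫ (restRepr (G ⋙ F)).inv =
      Functor.whiskerRight (restRepr F).inv ((Functor.whiskeringLeft _ _ (Type u)).obj G.op) ≫
        Functor.whiskerLeft (rest F.toProfunctor) (restRepr G).inv ≫
        (restTensor F.toProfunctor G.toProfunctor).hom ≫ restMap (reprTensor G F).hom := by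
  ext Y b y
  refine NatTrans.ext (funext fun d => ?_)
  ext x
  exact (show ∀ t : d.unop ⟶ F.obj (G.obj b.unop),
    Y.map t.op y = Y.map (t ≫ F.map (𝟙 _)).op y by intro t; simp) x

/-! ### Extension and restriction along a corepresentable distributor -/

/-- `lext_{C(F, 1)} ≅ F^*` (co-Yoneda): the coend `∫^c C(F d, c) × X(c)` is `X(F d)`. -/
def lextCorepr (F : D ⥤ C) :
    lext F.toProfunctorRev ≅ (Functor.whiskeringLeft _ _ (Type u)).obj F.op where
  hom :=
    { app := fun X =>
        { app := fun d => ↾(LextObj.lift (fun c (x : F.obj d.unop ⟶ c) s => X.map x.op s)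
            (fun f x s => by
              exact (ConcreteCategory.congr_hom (X.map_comp f.op (Quiver.Hom.op x)) s).symm))
          naturality := fun d d' v => by
            ext z; induction z using LextObj.ind with
            | h c x s =>
              exact ConcreteCategory.congr_hom (X.map_comp (Quiver.Hom.op x) (F.map v.unop).op) s }
      naturality := fun X Y φ => by
        ext d z; induction z using LextObj.ind with
        | h c x s => exact (NatTrans.naturality_apply φ (Quiver.Hom.op x) s).symm }
  inv :=
    { app := fun X =>
        { app := fun d => ↾(fun s => LextObj.mk (H := F.toProfunctorRev) (𝟙 (F.obj d.unop)) s)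
          naturality := fun d d' v => by
            ext s
            change LextObj.mk (H := F.toProfunctorRev) (𝟙 (F.obj d'.unop))
                (X.map (F.map v.unop).op s) =
              LextObj.mk (H := F.toProfunctorRev) (F.map v.unop ≫ 𝟙 (F.obj d.unop)) s
            refine (LextObj.sound (H := F.toProfunctorRev) (F.map v.unop)
              (𝟙 (F.obj d'.unop)) s).trans ?_
            congr 1
            change 𝟙 _ ≫ F.map v.unop = _
            simp }
      naturality := fun X Y φ => by ext d z; rfl }
  hom_inv_id := by
    ext X d z; induction z using LextObj.ind with
    | h c x s =>
      refine (LextObj.sound (H := F.toProfunctorRev) x (𝟙 (F.obj d.unop)) s).trans ?_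
      congr 1
      exact Category.id_comp (obj := C) x
  inv_hom_id := by
    ext X d s
    exact ConcreteCategory.congr_hom (X.map_id _) s

/-- `restUnit` is the mate of `lextUnit`. -/
lemma conjugateEquiv_lextUnit :
    CategoryTheory.conjugateEquiv Adjunction.id (lextAdj Profunctor.id) (lextUnit C).hom =
      (restUnit C).hom := by
  refine conjugateEquiv_eq_of _ _ _ _ fun X Y f => ?_
  rw [lextAdj, Adjunction.mkOfHomEquiv_homEquiv]
  ext c s
  refine NatTrans.ext (funext fun d => ?_)
  ext x
  exact NatTrans.naturality_apply f (Quiver.Hom.op x) s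

/-- `restTensor` is the mate of `lextTensor`. -/
lemma conjugateEquiv_lextTensor (G : Profunctor.{u} C D) (H : Profunctor.{u} B C) :
    CategoryTheory.conjugateEquiv ((lextAdj H).comp (lextAdj G)) (lextAdj (tensor G H))
      (lextTensor G H).inv = (restTensor G H).hom := by
  refine conjugateEquiv_eq_of _ _ _ _ fun X Y f => ?_
  rw [Adjunction.comp_homEquiv, lextAdj, lextAdj, lextAdj, Adjunction.mkOfHomEquiv_homEquiv,
    Adjunction.mkOfHomEquiv_homEquiv, Adjunction.mkOfHomEquiv_homEquiv]
  ext c s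
  refine NatTrans.ext (funext fun d => ?_)
  ext z; induction z using LextObj.ind with
  | h c x s => rfl

/-- Naturality of `lextCorepr` in the functor. -/
lemma lextCorepr_naturality {F G : D ⥤ C} (φ : F ⟶ G) :
    (lextCorepr G).hom ≫ (Functor.whiskeringLeft _ _ (Type u)).map (NatTrans.op φ) =
      lextMap (coreprMap φ) ≫ (lextCorepr F).hom := by
  ext X d z; induction z using LextObj.ind with
  | h c x s =>
    exact (ConcreteCategory.congr_hom (X.map_comp (Quiver.Hom.op x) (φ.app d.unop).op) s).symm

lemma lextCorepr_unit :
    lextMap (coreprUnit C).hom ≫ (lextUnit C).hom = (lextCorepr (𝟭 C)).hom ≫ (pullId C).hom := by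
  ext X d z; induction z using LextObj.ind with
  | h c x s => rfl

lemma lextCorepr_tensor (F : B ⥤ C) (G : C ⥤ D) :
    (lextCorepr (F ⋙ G)).hom ≫ (pullComp F G).hom =
      lextMap (coreprTensor F G).hom ≫ (lextTensor F.toProfunctorRev G.toProfunctorRev).inv ≫
        Functor.whiskerRight (lextCorepr G).hom (lext F.toProfunctorRev) ≫
          Functor.whiskerLeft _ (lextCorepr F).hom := by
  ext X d z; induction z using LextObj.ind with
  | h c x s =>
    exact (show ∀ t : X.obj (op (G.obj (F.obj d.unop))), t = X.map (G.map (𝟙 _)).op t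
      by intro t; simp) (X.map (Quiver.Hom.op x) s)

/-- `ran_{F^op} ≅ rest_{C(F, 1)}`, as right adjoints of the isomorphic functors `F^*` and
`lext_{C(F, 1)}`. -/
def ranRest (F : D ⥤ C) : F.op.ran ≅ rest F.toProfunctorRev :=
  conjugateIsoEquiv (F.op.ranAdjunction (Type u)) (lextAdj F.toProfunctorRev) (lextCorepr F)

lemma ranRest_naturality {F G : D ⥤ C} (φ : F ⟶ G) :
    CategoryTheory.conjugateEquiv (F.op.ranAdjunction (Type u)) (G.op.ranAdjunction (Type u))
      ((Functor.whiskeringLeft _ _ (Type u)).map (NatTrans.op φ)) ≫ (ranRest G).hom =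
      (ranRest F).hom ≫ restMap (coreprMap φ) := by
  rw [← conjugateEquiv_lextMap, ranRest, ranRest, CategoryTheory.conjugateIsoEquiv_apply_hom,
    CategoryTheory.conjugateIsoEquiv_apply_hom, CategoryTheory.conjugateEquiv_comp,
    CategoryTheory.conjugateEquiv_comp, lextCorepr_naturality]

lemma ranRest_unit :
    (restUnit C).hom ≫ restMap (coreprUnit C).hom =
      (conjugateIsoEquiv Adjunction.id ((𝟭 C).op.ranAdjunction (Type u)) (pullId C)).hom ≫
        (ranRest (𝟭 C)).hom := by
  rw [← conjugateEquiv_lextMap, ranRest, CategoryTheory.conjugateIsoEquiv_apply_hom,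
    CategoryTheory.conjugateIsoEquiv_apply_hom, ← conjugateEquiv_lextUnit,
    CategoryTheory.conjugateEquiv_comp,
    CategoryTheory.conjugateEquiv_comp, lextCorepr_unit]

lemma ranRest_tensor (F : B ⥤ C) (G : C ⥤ D) :
    (conjugateIsoEquiv ((G.op.ranAdjunction (Type u)).comp (F.op.ranAdjunction (Type u)))
      ((F ⋙ G).op.ranAdjunction (Type u)) (pullComp F G)).hom ≫ (ranRest (F ⋙ G)).hom =
      Functor.whiskerRight (ranRest F).hom G.op.ran ≫
        Functor.whiskerLeft (rest F.toProfunctorRev) (ranRest G).hom ≫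
        (restTensor F.toProfunctorRev G.toProfunctorRev).hom ≫ restMap (coreprTensor F G).hom := by
  -- Both sides are mates of composites of transformations between left adjoints.
  rw [← conjugateEquiv_lextMap, ranRest, ranRest, ranRest]
  simp only [CategoryTheory.conjugateIsoEquiv_apply_hom]
  rw [← conjugateEquiv_lextTensor,
    ← conjugateEquiv_whiskerRight _ _ (lextAdj F.toProfunctorRev),
    ← conjugateEquiv_whiskerLeft _ _ (G.op.ranAdjunction (Type u)),
    CategoryTheory.conjugateEquiv_comp, CategoryTheory.conjugateEquiv_comp,
    CategoryTheory.conjugateEquiv_comp, CategoryTheory.conjugateEquiv_comp, lextCorepr_tensor]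
  simp only [Category.assoc]

end

/-! ### Comparison of the pseudofunctors to toposes -/

/-- The transformation `Sh ∘ R ⟶ Sh^♭` with identity components, given on direct images by the
Yoneda isomorphisms `rest_{D(1, f)} ≅ f^*`. -/
def shRepresentable
    (hR : ∀ (X Y : SmallSite.{u}) (F : X.C ⥤ Y.C), IsMorphismOfSites X.J Y.J F →
      IsDistributorOfSites X.J Y.J F.toProfunctor)
    (R : IsCoherent (representable hR) (representableId hR) (representableComp hR)) :
    Pseudofunctor.StrongTrans (R.toPseudofunctor.comp sh) shFlat where
  app X := 𝟙 (sheafTopos X.unop.site.J)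
  naturality {a b} f := iconCell (a := sheafTopos a.unop.site.J) (b := sheafTopos b.unop.site.J)
    (f := shSystem.geom ((representable hR).map f)) (f' := flatSystem.geom f)
    (sheafGeomIso (restRepr f.unop.functor).symm)
  naturality_naturality {a b f g} η := iconCell_naturality _ _ _ _
    (sheafGeomIso_naturality _ _ _ _ (by
      -- The 2-cells of `flatSystem` are defined as mates of restrictions of 2-cells.
      refine (congrArg (· ≫ _) (Equiv.apply_symm_apply _ _)).trans ?_
      refine Eq.trans ?_ (congrArg (_ ≫ ·) (conjugateEquiv_lextMap _)).symm
      exact restRepr_naturality η.unop2.nat))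
  naturality_id a := iconCell_id _ _ _
    (sheafGeomIso_id _ _ (restUnit _).hom (flatSystem.id a).hom _ _
      (fun Y => shSystem.onDirect_geomId_app _ Y) (fun Y => flatSystem.onDirect_geomId_app _ Y)
      ((congrArg (_ ≫ ·) (conjugateEquiv_lextMap _)).trans restRepr_unit))
  naturality_comp f g := iconCell_comp _ _ _ _ _
    (sheafGeomIso_comp _ _ _ _ (restTensor _ _).hom (flatSystem.comp f g).hom _ _
      (fun Y => shSystem.onDirect_geomComp_app _ _ Y)
      (fun Y => flatSystem.onDirect_geomComp_app f g Y) (by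
      refine Eq.trans ?_ (congrArg (fun t => _ ≫ _ ≫ _ ≫ t) (conjugateEquiv_lextMap _)).symm
      exact restRepr_tensor g.unop.functor f.unop.functor))

/-- The transformation `Sh ∘ L ⟶ C` with identity components, given on direct images by the
isomorphisms `ran_{f^op} ≅ rest_{C(f, 1)}`. -/
def shCorepresentable
    (hL : ∀ (X Y : SmallSite.{u}) (F : X.C ⥤ Y.C), IsComorphismOfSites X.J Y.J F →
      IsDistributorOfSites Y.J X.J F.toProfunctorRev)
    (L : IsCoherent (corepresentable hL) (corepresentableId hL) (corepresentableComp hL)) :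
    Pseudofunctor.StrongTrans (L.toPseudofunctor.comp sh) shSharp where
  app X := 𝟙 (sheafTopos X.unco.site.J)
  naturality {a b} f := iconCell (a := sheafTopos a.unco.site.J) (b := sheafTopos b.unco.site.J)
    (f := shSystem.geom ((corepresentable hL).map f)) (f' := sharpSystem.geom f)
    (sheafGeomIso (ranRest f.unco.functor))
  naturality_naturality {a b f g} η := iconCell_naturality _ _ _ _
    (sheafGeomIso_naturality _ _ _ _ (by
      refine Eq.trans ?_ (congrArg (_ ≫ ·) (conjugateEquiv_lextMap _)).symm
      exact ranRest_naturality η.unco.nat))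
  naturality_id a := iconCell_id _ _ _
    (sheafGeomIso_id _ _ (restUnit _).hom (sharpSystem.id a).hom _ _
      (fun Y => shSystem.onDirect_geomId_app _ Y) (fun Y => sharpSystem.onDirect_geomId_app _ Y)
      ((congrArg (_ ≫ ·) (conjugateEquiv_lextMap _)).trans ranRest_unit))
  naturality_comp f g := iconCell_comp _ _ _ _ _
    (sheafGeomIso_comp _ _ _ _ (restTensor _ _).hom (sharpSystem.comp f g).hom _ _
      (fun Y => shSystem.onDirect_geomComp_app _ _ Y)
      (fun Y => sharpSystem.onDirect_geomComp_app f g Y) (by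
      refine Eq.trans ?_ (congrArg (fun t => _ ≫ _ ≫ _ ≫ t) (conjugateEquiv_lextMap _)).symm
      exact ranRest_tensor f.unco.functor g.unco.functor))

end

end SiteDistributors

theorem mainTheorem8 :
    ∃ (hR : ∀ (X Y : SmallSite.{u}) (F : X.C ⥤ Y.C), IsMorphismOfSites X.J Y.J F →
        IsDistributorOfSites X.J Y.J F.toProfunctor)
      (hL : ∀ (X Y : SmallSite.{u}) (F : X.C ⥤ Y.C), IsComorphismOfSites X.J Y.J F →
        IsDistributorOfSites Y.J X.J F.toProfunctorRev)
      (R : IsCoherent (representable hR) (representableId hR) (representableComp hR))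
      (L : IsCoherent (corepresentable hL) (corepresentableId hL) (corepresentableComp hL)),
      (∃ α : Pseudofunctor.StrongTrans (R.toPseudofunctor.comp sh) shFlat,
        ∀ X, α.app X = 𝟙 (sheafTopos X.unop.site.J)) ∧
      (∃ β : Pseudofunctor.StrongTrans (L.toPseudofunctor.comp sh) shSharp,
        ∀ X, β.app X = 𝟙 (sheafTopos X.unco.site.J)) := by
  have hR : ∀ (X Y : SmallSite.{u}) (F : X.C ⥤ Y.C), IsMorphismOfSites X.J Y.J F →
      IsDistributorOfSites X.J Y.J F.toProfunctor := fun _ _ _ hF => hF.isDistributorOfSites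
  have hL : ∀ (X Y : SmallSite.{u}) (F : X.C ⥤ Y.C), IsComorphismOfSites X.J Y.J F →
      IsDistributorOfSites Y.J X.J F.toProfunctorRev := fun _ _ _ hF => hF.isDistributorOfSites
  exact ⟨hR, hL, isCoherent_representable hR, isCoherent_corepresentable hL,
    ⟨shRepresentable hR _, fun _ => rfl⟩, ⟨shCorepresentable hL _, fun _ => rfl⟩⟩
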